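/- Let $n\ge 1$ and $j\in\{1,\dots,n\}$, and for each $k\in\{1,\dots,n\}$ let $A_k=\begin{pmatrix}a_k&b_k\\ c_k&d_k\end{pmatrix}$ be a real matrix with determinant $1$ such that $b_k\neq 0$ and $a_k=d_k$. Put $\boldsymbol A=(A_1,\dots,A_n)$. For a complex-valued Schwartz function $f\in\mathscr S(\mathbb R^n)$ and $x\in\mathbb R^n$, the $j$th linear canonical Riesz transform of $f$ at $x$ is $$R_j^{\boldsymbol A}(f)(x):=\frac{\Gamma(\frac{n+1}{2})}{\pi^{\frac{n+1}{2}}}\,e^{-i\sum_{k=1}^n\frac{d_k}{2b_k}x_k^2}\ \lim_{\varepsilon\to0^+}\int_{|x-y|\ge\varepsilon}\frac{(x_j-y_j)\,f(y)\,e^{i\sum_{k=1}^n\frac{a_k}{2b_k}y_k^2}}{|x-y|^{n+1}}\,dy .$$ Then these integrals converge absolutely and the limit exists for every $f\in\mathscr S(\mathbb R^n)$ and every $x\in\mathbb R^n$; and, for every $p\in(1,\infty)$, $R_j^{\boldsymbol A}$ extends to a bounded linear operator on $L^p(\mathbb R^n)$: there exist a linear operator $T:L^p(\mathbb R^n)\to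 L^p(\mathbb R^n)$ with $Tf=R_j^{\boldsymbol A}(f)$ almost everywhere for all $f\in\mathscr S(\mathbb R^n)$, and a constant $C>0$, such that $\|Tf\|_{L^p(\mathbb R^n)}\le C\|f\|_{L^p(\mathbb R^n)}$ for all $f\in L^p(\mathbb R^n)$. -/

import Mathlib

open MeasureTheory Filter Topology
open scoped ENNReal SchwartzMap

noncomputable section

/-- The chirp function `e_{a,b}(x) = exp (i ∑ k, b k / (2 a k) * (x k) ^ 2)` on `ℝⁿ`. -/
def chirp {n : ℕ} (a b : Fin n → ℝ) (x : EuclideanSpace ℝ (Fin n)) : ℂ :=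
  Complex.exp (Complex.I * ((∑ k, b k / (2 * a k) * x k ^ 2 : ℝ) : ℂ))

/-- The normalizing constant `Γ((n + 1) / 2) / π ^ ((n + 1) / 2)`. -/
def rieszConst (n : ℕ) : ℝ :=
  Real.Gamma (((n : ℝ) + 1) / 2) / Real.pi ^ (((n : ℝ) + 1) / 2)

/-- The integrand `(x j - y j) f(y) e_{b,a}(y) / |x - y| ^ (n + 1)` of the linear canonical Riesz
transform. The matrix `A k` has the rows `(a k, b k)` and `(c k, d k)`, and determinant one, so
that `a k = A k 0 0`, `b k = A k 0 1`, `c k = A k 1 0`, `d k = A k 1 1`. -/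
def lcrtIntegrand {n : ℕ} (A : Fin n → Matrix.SpecialLinearGroup (Fin 2) ℝ) (j : Fin n)
    (f : EuclideanSpace ℝ (Fin n) → ℂ) (x y : EuclideanSpace ℝ (Fin n)) : ℂ :=
  ((x j - y j : ℝ) : ℂ) * f y * chirp (fun k => A k 0 1) (fun k => A k 0 0) y /
    ((‖x - y‖ ^ (n + 1) : ℝ) : ℂ)

/-- The truncated integral, over `|x - y| ≥ ε`. -/
def lcrtTruncated {n : ℕ} (A : Fin n → Matrix.SpecialLinearGroup (Fin 2) ℝ) (j : Fin n)
    (f : EuclideanSpace ℝ (Fin n) → ℂ) (x : EuclideanSpace ℝ (Fin n)) (ε : ℝ) : ℂ :=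
  ∫ y in {y : EuclideanSpace ℝ (Fin n) | ε ≤ ‖x - y‖}, lcrtIntegrand A j f x y

/-- The `j`-th linear canonical Riesz transform of `f` at `x`: the constant times `e_{b,-d}(x)`
times the principal value, i.e. the limit of the truncated integrals as `ε → 0⁺`. -/
def lcrt {n : ℕ} (A : Fin n → Matrix.SpecialLinearGroup (Fin 2) ℝ) (j : Fin n)
    (f : EuclideanSpace ℝ (Fin n) → ℂ) (x : EuclideanSpace ℝ (Fin n)) : ℂ :=
  (rieszConst n : ℂ) * chirp (fun k => A k 0 1) (fun k => -(A k 1 1)) x *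
    limUnder (𝓝[>] (0 : ℝ)) (lcrtTruncated A j f x)

end

/-!
The chirps have modulus one, so the linear canonical Riesz transform of a Schwartz function `f` has
the same absolute value as the ordinary Riesz transform of `g = f * chirp`, a function that is
`C ^ 1` and integrable. The kernel is odd, so its principal value is the absolutely convergent
integral `foldedRiesz` over the differences `g (x - u) - g (x + u)`
(`tendsto_setIntegral_rieszKernel`), and everything reduces to an `L ^ p` bound for `foldedRiesz`
on functions of this kind; density of the Schwartz functions does the rest.

The bound is obtained by a version of the method of rotations without polar coordinates. Writing
`|u| ^ (-n - 1) = (n + 1) ∫_{s ≥ |u|} s ^ (-n - 2) ds`, exchanging the integrals and substituting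
`u = s z` presents `foldedRiesz` as an average, over `z` in the unit ball with weight `z j`, of
Hilbert transforms along the lines of direction `z` (`foldedRiesz_eq_integral_dirHilbert`). By
Jensen's inequality it is enough to bound those uniformly in `z`. Disintegrating Lebesgue measure
along the lines parallel to `z` (`exists_lintegral_eq_lintegral_lines`) leaves a statement on the
real line: the convolutions with `u / (u ^ 2 + ε ^ 2)` are bounded on `L ^ p`, uniformly in `ε`
(`exists_lintegral_conjPoisson_rpow_le`).

On the line this is M. Riesz's theorem. For `1 < p ≤ 2` and `f ≥ 0`, not almost everywhere
zero, the function `F (z) = ∫ f(t) i / (z - t) dt` maps the upper half-plane to the right half-plane,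
its real and imaginary parts being, up to the factor `π`, the Poisson and the conjugate Poisson
integral of `f`. The pointwise
inequality `|Im w| ^ p ≤ A (Re w) ^ p - B Re (w ^ p)` for `Re w > 0` (`exists_abs_im_rpow_le`) is
applied to `w = F (x + i ε)` and integrated in `x`: the last term drops out by Cauchy's theorem,
as `F ^ p` decays like `|z| ^ (-p)`, and the first one is bounded by `∫ f ^ p`. For `p ≥ 2` the
bound follows by duality, the kernel being odd.
-/

/-! ### An integral inequality and a pointwise inequality on the half-plane -/

/-- Jensen's inequality for the power `p`, on a measure space of arbitrary total mass. -/
theorem lintegral_rpow_le_measure_univ_mul {α : Type*} [MeasurableSpace α] (μ : Measure α)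
    {f : α → ℝ≥0∞} (hf : AEMeasurable f μ) {p : ℝ} (hp : 1 < p) :
    (∫⁻ a, f a ∂μ) ^ p ≤ μ Set.univ ^ (p - 1) * ∫⁻ a, f a ^ p ∂μ := by
  have hpq := Real.HolderConjugate.conjExponent hp
  have h := ENNReal.lintegral_mul_le_Lp_mul_Lq μ hpq hf (aemeasurable_const (b := (1 : ℝ≥0∞)))
  simp only [Pi.mul_apply, mul_one, ENNReal.one_rpow, lintegral_const, one_mul] at h
  have h2 := ENNReal.rpow_le_rpow h (by linarith : 0 ≤ p)
  rw [ENNReal.mul_rpow_of_nonneg _ _ (by linarith), ← ENNReal.rpow_mul, ← ENNReal.rpow_mul,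
    one_div_mul_cancel (by linarith), ENNReal.rpow_one, mul_comm] at h2
  convert! h2 using 3
  rw [Real.conjExponent]
  have : p - 1 ≠ 0 := by linarith
  field_simp

/-- On the right half-plane `|Im w| ^ p` is controlled by `(Re w) ^ p` up to a multiple of the
harmonic function `Re (w ^ p)`. This is the pointwise inequality that turns Cauchy's theorem into
the `L ^ p` bound of the conjugate function. It holds because `cos (p θ) < 0` for `θ` close to
`π / 2`, while `cos θ` is bounded below on the remaining angles. -/
theorem exists_abs_im_rpow_le {p : ℝ} (hp : 1 < p) (hp2 : p ≤ 2) :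
    ∃ A B : ℝ, 0 ≤ A ∧ 0 ≤ B ∧ ∀ w : ℂ, 0 < w.re →
      |w.im| ^ p ≤ A * w.re ^ p - B * (w ^ (p : ℂ)).re := by
  have hpi := Real.pi_pos
  -- `θ₀` separates the angles: `p θ₀` exceeds `π / 2`, but `θ₀` stays below it
  obtain ⟨θ₀, h1, h2⟩ : ∃ θ₀, Real.pi / (2 * p) < θ₀ ∧ θ₀ < Real.pi / 2 := by
    apply exists_between
    apply div_lt_div_of_pos_left hpi (by norm_num) (by linarith)
  have h1' : Real.pi / 2 < p * θ₀ := by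
    rw [div_lt_iff₀ (by linarith)] at h1
    linarith
  have hθ₀ : 0 < θ₀ := lt_trans (by positivity) h1
  have h3 : p * θ₀ ≤ Real.pi := by nlinarith
  have hκ : Real.cos (p * θ₀) < 0 :=
    Real.cos_neg_of_pi_div_two_lt_of_lt h1' (by linarith)
  have hδ : 0 < Real.cos θ₀ := Real.cos_pos_of_mem_Ioo ⟨by linarith, h2⟩
  set κ := -Real.cos (p * θ₀) with hκdef
  have hκ0 : 0 < κ := by linarith
  set δ := Real.cos θ₀ ^ p with hδdef
  have hδ0 : 0 < δ := Real.rpow_pos_of_pos hδ p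
  refine ⟨(1 + 1 / κ) / δ, 1 / κ, by positivity, by positivity, fun w hw => ?_⟩
  have hw0 : w ≠ 0 := by rintro rfl; simp at hw
  have hr : 0 < ‖w‖ := norm_pos_iff.2 hw0
  set θ := |w.arg| with hθ
  have hθ2 : θ ≤ Real.pi / 2 := Complex.abs_arg_le_pi_div_two_iff.2 hw.le
  have hθ0 : 0 ≤ θ := abs_nonneg _
  have him : |w.im| = ‖w‖ * |Real.sin w.arg| := by
    rw [← Complex.norm_mul_sin_arg w, abs_mul, abs_norm]
  have hre : w.re = ‖w‖ * Real.cos θ := by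
    rw [hθ, Real.cos_abs, Complex.norm_mul_cos_arg]
  have hcosp : (w ^ (p : ℂ)).re = ‖w‖ ^ p * Real.cos (p * θ) := by
    rw [Complex.cpow_ofReal_re, hθ, ← Real.cos_abs (w.arg * p), abs_mul,
      abs_of_pos (by linarith : 0 < p), mul_comm p]
  have hcos : 0 ≤ Real.cos θ := by
    apply Real.cos_nonneg_of_mem_Icc; constructor <;> linarith
  rw [him, hcosp, hre, Real.mul_rpow hr.le (abs_nonneg _), Real.mul_rpow hr.le hcos]
  have hsin : |Real.sin w.arg| ^ p ≤ 1 :=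
    Real.rpow_le_one (abs_nonneg _) (Real.abs_sin_le_one _) (by linarith)
  have key : 1 ≤ (1 + 1 / κ) / δ * Real.cos θ ^ p - 1 / κ * Real.cos (p * θ) := by
    rcases le_total θ θ₀ with h | h
    · have hc : δ ≤ Real.cos θ ^ p := by
        apply Real.rpow_le_rpow hδ.le _ (by linarith)
        exact Real.cos_le_cos_of_nonneg_of_le_pi hθ0 (by linarith) h
      have h5 : (1 + 1 / κ) ≤ (1 + 1 / κ) / δ * Real.cos θ ^ p := by
        rw [div_mul_eq_mul_div, le_div_iff₀ hδ0]
        exact mul_le_mul_of_nonneg_left hc (by positivity)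
      have h6 : 1 / κ * Real.cos (p * θ) ≤ 1 / κ * 1 :=
        mul_le_mul_of_nonneg_left (Real.cos_le_one _) (by positivity)
      linarith
    · have hc : Real.cos (p * θ) ≤ -κ := by
        rw [hκdef, neg_neg]
        apply Real.cos_le_cos_of_nonneg_of_le_pi (by positivity) _ (by gcongr)
        nlinarith
      have h6 : 1 / κ * Real.cos (p * θ) ≤ 1 / κ * (-κ) :=
        mul_le_mul_of_nonneg_left hc (by positivity)
      have h7 : 1 / κ * (-κ) = -1 := by field_simp
      have h8 : 0 ≤ (1 + 1 / κ) / δ * Real.cos θ ^ p := by positivity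
      linarith
  have := mul_le_mul_of_nonneg_left (hsin.trans key) (Real.rpow_nonneg hr.le p)
  linarith

/-! ### The analytic extension of a function on the line to the upper half-plane -/

/-- The function `z ↦ ∫ f(t) i / (z - t) dt` on the upper half-plane, for a real function `f` on
the line. At `x + i y` its real part is `π` times the Poisson integral of `f`, and its imaginary
part is `π` times the conjugate Poisson integral. -/
noncomputable def halfPlaneExtension (f : ℝ → ℝ) (z : ℂ) : ℂ :=
  ∫ t, (f t : ℂ) * (Complex.I / (z - t))

theorem im_le_norm_sub_ofReal {z : ℂ} (hz : 0 < z.im) (t : ℝ) : z.im ≤ ‖z - t‖ := by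
  have := Complex.abs_im_le_norm (z - t)
  rw [Complex.sub_im, Complex.ofReal_im, sub_zero, abs_of_pos hz] at this
  exact this

theorem sub_ofReal_ne_zero {z : ℂ} (hz : 0 < z.im) (t : ℝ) : z - t ≠ 0 :=
  norm_pos_iff.1 (hz.trans_le (im_le_norm_sub_ofReal hz t))

theorem integrable_halfPlaneExtension {f : ℝ → ℝ} (hf : Integrable f) {z : ℂ} (hz : 0 < z.im) :
    Integrable fun t : ℝ => (f t : ℂ) * (Complex.I / (z - t)) := by
  refine hf.ofReal.mul_bdd (c := 1 / z.im) (Measurable.aestronglyMeasurable (by fun_prop))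
    (Eventually.of_forall fun t => ?_)
  rw [norm_div, Complex.norm_I]
  exact one_div_le_one_div_of_le hz (im_le_norm_sub_ofReal hz t)

theorem normSq_add_mul_I_sub_ofReal (x ε t : ℝ) :
    Complex.normSq ((x + ε * Complex.I : ℂ) - t) = (x - t) ^ 2 + ε ^ 2 := by
  simp [Complex.normSq_apply]; ring

theorem halfPlaneExtension_re {f : ℝ → ℝ} (hf : Integrable f) (x : ℝ) {ε : ℝ} (hε : 0 < ε) :
    (halfPlaneExtension f (x + ε * Complex.I)).re =
      ∫ t, f t * (ε / ((x - t) ^ 2 + ε ^ 2)) := by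
  have h := integral_re (integrable_halfPlaneExtension hf
    (z := x + ε * Complex.I) (by simpa using hε))
  refine Eq.trans h.symm (integral_congr_ae (Eventually.of_forall fun t => ?_))
  change ((f t : ℂ) * (Complex.I / ((x + ε * Complex.I : ℂ) - t))).re = _
  rw [Complex.re_ofReal_mul, Complex.div_re, normSq_add_mul_I_sub_ofReal]
  simp

theorem halfPlaneExtension_im {f : ℝ → ℝ} (hf : Integrable f) (x : ℝ) {ε : ℝ} (hε : 0 < ε) :
    (halfPlaneExtension f (x + ε * Complex.I)).im =
      ∫ t, f t * ((x - t) / ((x - t) ^ 2 + ε ^ 2)) := by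
  have h := integral_im (integrable_halfPlaneExtension hf
    (z := x + ε * Complex.I) (by simpa using hε))
  refine Eq.trans h.symm (integral_congr_ae (Eventually.of_forall fun t => ?_))
  change ((f t : ℂ) * (Complex.I / ((x + ε * Complex.I : ℂ) - t))).im = _
  rw [Complex.im_ofReal_mul, Complex.div_im, normSq_add_mul_I_sub_ofReal]
  simp

theorem differentiableAt_halfPlaneExtension {f : ℝ → ℝ} (hf : Integrable f) {z : ℂ}
    (hz : 0 < z.im) : DifferentiableAt ℂ (halfPlaneExtension f) z := by
  have hs : {w : ℂ | z.im / 2 < w.im} ∈ 𝓝 z :=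
    (isOpen_lt continuous_const Complex.continuous_im).mem_nhds (by simp; linarith)
  have hpos : ∀ w ∈ {w : ℂ | z.im / 2 < w.im}, 0 < w.im := fun w hw =>
    lt_trans (by positivity) hw
  refine (hasDerivAt_integral_of_dominated_loc_of_deriv_le (μ := volume)
    (F := fun (w : ℂ) (t : ℝ) => (f t : ℂ) * (Complex.I / (w - t)))
    (F' := fun (w : ℂ) (t : ℝ) => (f t : ℂ) * (-Complex.I / (w - t) ^ 2))
    (bound := fun t => ‖f t‖ * (1 / (z.im / 2) ^ 2)) hs ?_
    (integrable_halfPlaneExtension hf hz) ?_ ?_ ?_ ?_).2.differentiableAt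
  · filter_upwards [hs] with w hw
    exact (integrable_halfPlaneExtension hf (hpos w hw)).aestronglyMeasurable
  · exact hf.ofReal.aestronglyMeasurable.mul (Measurable.aestronglyMeasurable (by fun_prop))
  · refine Eventually.of_forall fun t w hw => ?_
    rw [norm_mul, norm_div, norm_neg, Complex.norm_I, norm_pow, Complex.norm_real]
    refine mul_le_mul_of_nonneg_left ?_ (norm_nonneg _)
    refine one_div_le_one_div_of_le (by positivity) ?_
    exact pow_le_pow_left₀ (by positivity)
      ((le_of_lt hw).trans (im_le_norm_sub_ofReal (hpos w hw) t)) 2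
  · exact hf.norm.mul_const _
  · refine Eventually.of_forall fun t w hw => ?_
    have hne := sub_ofReal_ne_zero (hpos w hw) t
    have h1 : HasDerivAt (fun w : ℂ => w - t) 1 w := (hasDerivAt_id w).sub_const _
    have h2 := ((h1.inv hne).const_mul Complex.I).const_mul (f t : ℂ)
    convert! h2 using 1
    field_simp

/-- For `f` supported in `[-M, M]`, the extension decays like `1 / |z|`. -/
theorem norm_halfPlaneExtension_le {f : ℝ → ℝ} (hf : Integrable f) {M : ℝ}
    (hM : ∀ t, M < |t| → f t = 0) {z : ℂ} (hz : 0 < z.im) (hzM : 2 * M ≤ ‖z‖) :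
    ‖halfPlaneExtension f z‖ ≤ (2 * ∫ t, ‖f t‖) / ‖z‖ := by
  have hz0 : 0 < ‖z‖ := norm_pos_iff.2 (by rintro rfl; simp at hz)
  have : (2 * ∫ t, ‖f t‖) / ‖z‖ = ∫ t, ‖f t‖ * (2 / ‖z‖) := by
    rw [integral_mul_const]; ring
  rw [this]
  refine norm_integral_le_of_norm_le (hf.norm.mul_const _) (Eventually.of_forall fun t => ?_)
  rw [norm_mul, Complex.norm_real, norm_div, Complex.norm_I]
  rcases le_or_gt |t| M with h | h
  · refine mul_le_mul_of_nonneg_left ?_ (norm_nonneg _)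
    have h1 : ‖z‖ / 2 ≤ ‖z - t‖ := by
      have := norm_sub_norm_le z (t : ℂ)
      rw [Complex.norm_real, Real.norm_eq_abs] at this
      linarith
    rw [div_le_div_iff₀ (by linarith) hz0]
    linarith
  · simp [hM t h]

/-- Cauchy's theorem on the square with base `[-R, R]` at height `ε`: the integral of the power
over the base is as small as the integrals over the other three sides. -/
theorem norm_integral_halfPlaneExtension_cpow_le {f : ℝ → ℝ} (hf : Integrable f) {M : ℝ}
    (hM : ∀ t, M < |t| → f t = 0)
    (hpos : ∀ z : ℂ, 0 < z.im → 0 < (halfPlaneExtension f z).re) {p : ℝ} (hp : 1 < p)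
    {ε R : ℝ} (hε : 0 < ε) (hR : 0 < R) (hRM : 2 * M ≤ R) :
    ‖∫ x in (-R)..R, halfPlaneExtension f (x + ε * Complex.I) ^ (p : ℂ)‖ ≤
      4 * R * ((2 * ∫ t, ‖f t‖) / R) ^ p := by
  set K := 2 * ∫ t, ‖f t‖ with hK
  have hK0 : 0 ≤ K := mul_nonneg zero_le_two (integral_nonneg fun _ => norm_nonneg _)
  set Φ : ℂ → ℂ := fun z => halfPlaneExtension f z ^ (p : ℂ) with hΦ
  have hbound : ∀ z : ℂ, 0 < z.im → R ≤ ‖z‖ → ‖Φ z‖ ≤ (K / R) ^ p := by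
    intro z hz hzR
    rw [hΦ]
    simp only [Complex.norm_cpow_real]
    refine Real.rpow_le_rpow (norm_nonneg _) ?_ (by linarith)
    refine (norm_halfPlaneExtension_le hf hM hz (by linarith)).trans ?_
    exact div_le_div_of_nonneg_left hK0 hR hzR
  have hd : DifferentiableOn ℂ Φ
      (Set.uIcc (⟨-R, ε⟩ : ℂ).re (⟨R, ε + R⟩ : ℂ).re ×ℂ
        Set.uIcc (⟨-R, ε⟩ : ℂ).im (⟨R, ε + R⟩ : ℂ).im) := by
    intro z hz
    have hz' : 0 < z.im := by
      have := (Complex.mem_reProdIm.1 hz).2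
      simp only [Set.uIcc_of_le (by linarith : ε ≤ ε + R)] at this
      linarith [this.1]
    exact ((differentiableAt_halfPlaneExtension hf hz').cpow_const
      (Or.inl (hpos z hz'))).differentiableWithinAt
  have h := Complex.integral_boundary_rect_eq_zero_of_differentiableOn Φ ⟨-R, ε⟩ ⟨R, ε + R⟩ hd
  simp only at h
  have e : (∫ x in (-R)..R, Φ (x + ε * Complex.I)) =
      (∫ x in (-R)..R, Φ (x + (ε + R : ℝ) * Complex.I)) -
      Complex.I • (∫ y in ε..(ε + R), Φ ((R : ℝ) + y * Complex.I)) +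
      Complex.I • (∫ y in ε..(ε + R), Φ ((-R : ℝ) + y * Complex.I)) := by
    linear_combination (exp := 1) h
  have b1 : ‖∫ x in (-R)..R, Φ (x + (ε + R : ℝ) * Complex.I)‖ ≤ (K / R) ^ p * |R - (-R)| := by
    refine intervalIntegral.norm_integral_le_of_norm_le_const fun x _ => ?_
    refine hbound _ (by simp; linarith) ?_
    refine le_trans ?_ (Complex.abs_im_le_norm _)
    rw [Complex.add_im]
    simp [abs_of_pos (by linarith : 0 < ε + R), hε.le]
  have b2 : ∀ s : ℝ, |s| = R →
      ‖Complex.I • ∫ y in ε..(ε + R), Φ ((s : ℝ) + y * Complex.I)‖ ≤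
        (K / R) ^ p * |ε + R - ε| := by
    intro s hs
    rw [norm_smul, Complex.norm_I, one_mul]
    refine intervalIntegral.norm_integral_le_of_norm_le_const fun y hy => ?_
    rw [Set.uIoc_of_le (by linarith)] at hy
    refine hbound _ (by simp; linarith [hy.1]) ?_
    refine le_trans ?_ (Complex.abs_re_le_norm _)
    simp [hs]
  have b2a := b2 R (abs_of_pos hR)
  have b2b := b2 (-R) (by rw [abs_neg, abs_of_pos hR])
  rw [show R - -R = 2 * R by ring, abs_of_pos (by linarith)] at b1
  rw [show ε + R - ε = R by ring, abs_of_pos hR] at b2a b2b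
  change ‖∫ x in (-R)..R, Φ (x + ε * Complex.I)‖ ≤ _
  rw [e]
  refine (norm_add_le _ _).trans ?_
  have := norm_sub_le (∫ x in (-R)..R, Φ (x + (ε + R : ℝ) * Complex.I))
    (Complex.I • (∫ y in ε..(ε + R), Φ ((R : ℝ) + y * Complex.I)))
  linarith

/-! ### The conjugate Poisson integral on the line, for exponents at most two -/

theorem lintegral_poissonKernel {ε : ℝ} (hε : 0 < ε) :
    ∫⁻ u : ℝ, ENNReal.ofReal (ε / (u ^ 2 + ε ^ 2)) = ENNReal.ofReal Real.pi := by
  have e : ∀ u : ℝ, ε / (u ^ 2 + ε ^ 2) = ε⁻¹ * (1 + (u / ε) ^ 2)⁻¹ := fun u => by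
    have : u ^ 2 + ε ^ 2 ≠ 0 := by positivity
    have h2 : 1 + (u / ε) ^ 2 ≠ 0 := by positivity
    field_simp
    ring
  have hi : Integrable fun u : ℝ => ε⁻¹ * (1 + (u / ε) ^ 2)⁻¹ :=
    (integrable_inv_one_add_sq.comp_div hε.ne').const_mul _
  simp_rw [e]
  rw [← ofReal_integral_eq_lintegral_ofReal hi (Eventually.of_forall fun u => by positivity)]
  congr 1
  rw [integral_const_mul, Measure.integral_comp_div (fun u : ℝ => (1 + u ^ 2)⁻¹) ε,
    integral_univ_inv_one_add_sq, smul_eq_mul, abs_of_pos hε, ← mul_assoc,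
    inv_mul_cancel₀ hε.ne', one_mul]

/-- The Poisson integral is bounded on `L ^ p`: Jensen's inequality for the kernel, whose total mass
is `π`. -/
theorem lintegral_poisson_rpow_le {f : ℝ → ℝ} (hfm : Measurable f) (hf : Integrable f)
    (h0 : ∀ t, 0 ≤ f t) {p : ℝ} (hp : 1 < p) {ε : ℝ} (hε : 0 < ε) :
    ∫⁻ x : ℝ, ENNReal.ofReal (∫ t, f t * (ε / ((x - t) ^ 2 + ε ^ 2))) ^ p ≤
      ENNReal.ofReal Real.pi ^ p * ∫⁻ t, ENNReal.ofReal (f t) ^ p := by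
  have hk0 : ∀ u : ℝ, 0 ≤ ε / (u ^ 2 + ε ^ 2) := fun u => by positivity
  set k : ℝ → ℝ≥0∞ := fun u => ENNReal.ofReal (ε / (u ^ 2 + ε ^ 2)) with hk
  have hkm : Measurable k := by fun_prop
  have hkb : ∀ u : ℝ, ‖ε / (u ^ 2 + ε ^ 2)‖ ≤ 1 / ε := fun u => by
    rw [Real.norm_of_nonneg (hk0 u), div_le_div_iff₀ (by positivity) hε]
    nlinarith [sq_nonneg u]
  have h1 : ∀ x : ℝ, ENNReal.ofReal (∫ t, f t * (ε / ((x - t) ^ 2 + ε ^ 2))) ^ p ≤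
      ENNReal.ofReal Real.pi ^ (p - 1) * ∫⁻ t, k (x - t) * ENNReal.ofReal (f t) ^ p := by
    intro x
    have hkx : Measurable fun t => k (x - t) := by fun_prop
    have hint : Integrable fun t => f t * (ε / ((x - t) ^ 2 + ε ^ 2)) :=
      hf.mul_bdd (c := 1 / ε) (Measurable.aestronglyMeasurable (by fun_prop))
        (Eventually.of_forall fun t => hkb _)
    have h := lintegral_rpow_le_measure_univ_mul (volume.withDensity fun t => k (x - t))
      (f := fun t => ENNReal.ofReal (f t)) (by fun_prop) hp
    rw [lintegral_withDensity_eq_lintegral_mul _ hkx (by fun_prop),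
      lintegral_withDensity_eq_lintegral_mul _ hkx (by fun_prop),
      withDensity_apply _ MeasurableSet.univ, Measure.restrict_univ,
      lintegral_sub_left_eq_self k x, hk, lintegral_poissonKernel hε] at h
    rw [ofReal_integral_eq_lintegral_ofReal hint
      (Eventually.of_forall fun t => mul_nonneg (h0 t) (hk0 _))]
    refine le_trans (le_of_eq ?_) h
    congr 1
    refine lintegral_congr fun t => ?_
    rw [ENNReal.ofReal_mul (h0 t), mul_comm]
    rfl
  have hm : Measurable (Function.uncurry fun x t => k (x - t) * ENNReal.ofReal (f t) ^ p) := by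
    unfold Function.uncurry
    fun_prop
  refine (lintegral_mono h1).trans ?_
  rw [lintegral_const_mul _ (by exact hm.lintegral_prod_right'),
    lintegral_lintegral_swap hm.aemeasurable]
  have h2 : ∀ t, ∫⁻ x, k (x - t) * ENNReal.ofReal (f t) ^ p =
      ENNReal.ofReal Real.pi * ENNReal.ofReal (f t) ^ p := fun t => by
    rw [lintegral_mul_const _ (by fun_prop), lintegral_sub_right_eq_self k t, hk,
      lintegral_poissonKernel hε]
  simp_rw [h2]
  rw [lintegral_const_mul _ (by fun_prop), ← mul_assoc]
  gcongr
  have hpi0 : ENNReal.ofReal Real.pi ≠ 0 := by simp [Real.pi_pos]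
  conv_lhs => rw [← ENNReal.rpow_one (ENNReal.ofReal Real.pi), ← ENNReal.rpow_mul, one_mul,
    ← ENNReal.rpow_add _ _ hpi0 ENNReal.ofReal_ne_top]
  rw [sub_add_cancel]

/-- The conjugate Poisson kernel `u / (u ^ 2 + ε ^ 2)`, without the factor `1 / π`; it regularizes
the kernel `1 / u` of the Hilbert transform. -/
noncomputable def conjKernel (ε u : ℝ) : ℝ := u / (u ^ 2 + ε ^ 2)

theorem conjKernel_neg (ε u : ℝ) : conjKernel ε (-u) = -conjKernel ε u := by
  simp [conjKernel, neg_div]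

theorem norm_conjKernel_le {ε : ℝ} (hε : 0 < ε) (u : ℝ) : ‖conjKernel ε u‖ ≤ 1 / ε := by
  have h : 0 < u ^ 2 + ε ^ 2 := by positivity
  rw [conjKernel, norm_div, Real.norm_eq_abs, Real.norm_of_nonneg h.le,
    div_le_div_iff₀ h hε]
  nlinarith [sq_nonneg (|u| - ε), sq_abs u, abs_nonneg u]

@[fun_prop]
theorem continuous_conjKernel {ε : ℝ} (hε : 0 < ε) : Continuous (conjKernel ε) :=
  continuous_id.div (by fun_prop) fun u => by positivity

@[fun_prop]
theorem measurable_conjKernel (ε : ℝ) : Measurable (conjKernel ε) := by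
  unfold conjKernel
  fun_prop

/-- The conjugate Poisson integral of `f` at height `ε`, without the factor `1 / π`. -/
noncomputable def conjPoisson {E : Type*} [NormedAddCommGroup E] [NormedSpace ℝ E] (ε : ℝ)
    (f : ℝ → E) (x : ℝ) : E :=
  ∫ t, conjKernel ε (x - t) • f t

section

variable {E : Type*} [NormedAddCommGroup E] [NormedSpace ℝ E]

theorem integrable_conjKernel_smul {f : ℝ → E} (hf : Integrable f) {ε : ℝ} (hε : 0 < ε) (x : ℝ) :
    Integrable fun t => conjKernel ε (x - t) • f t :=
  hf.bdd_smul (1 / ε) (Measurable.aestronglyMeasurable (by fun_prop))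
    (Eventually.of_forall fun t => norm_conjKernel_le hε _)

theorem conjPoisson_sub {f g : ℝ → E} (hf : Integrable f) (hg : Integrable g) {ε : ℝ}
    (hε : 0 < ε) (x : ℝ) :
    conjPoisson ε (fun t => f t - g t) x = conjPoisson ε f x - conjPoisson ε g x := by
  simp only [conjPoisson, smul_sub]
  exact integral_sub (integrable_conjKernel_smul hf hε x) (integrable_conjKernel_smul hg hε x)

theorem continuous_conjPoisson {f : ℝ → E} (hf : Integrable f) {ε : ℝ} (hε : 0 < ε) :
    Continuous (conjPoisson ε f) := by
  refine continuous_of_dominated (bound := fun t => 1 / ε * ‖f t‖)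
    (fun x => (integrable_conjKernel_smul hf hε x).aestronglyMeasurable)
    (fun x => Eventually.of_forall fun t => ?_) (hf.norm.const_mul _)
    (Eventually.of_forall fun t => ?_)
  · rw [norm_smul]
    exact mul_le_mul_of_nonneg_right (norm_conjKernel_le hε _) (norm_nonneg _)
  · exact ((continuous_conjKernel hε).comp (by fun_prop)).smul continuous_const

/-- A bound for the conjugate Poisson integrals of the truncations of an integrable function to
bounded intervals passes to the function, by Fatou's lemma. -/
theorem lintegral_conjPoisson_le_of_indicator {f : ℝ → E} (hf : Integrable f) {ε : ℝ}
    (hε : 0 < ε) {p : ℝ} {C : ℝ≥0∞}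
    (h : ∀ n : ℕ, ∫⁻ x, ‖conjPoisson ε ((Set.Icc (-n : ℝ) n).indicator f) x‖ₑ ^ p ≤ C) :
    ∫⁻ x, ‖conjPoisson ε f x‖ₑ ^ p ≤ C := by
  have hfi : ∀ n : ℕ, Integrable ((Set.Icc (-n : ℝ) n).indicator f) := fun n =>
    hf.indicator measurableSet_Icc
  have hlim : ∀ x, Tendsto
      (fun n : ℕ => ‖conjPoisson ε ((Set.Icc (-n : ℝ) n).indicator f) x‖ₑ ^ p) atTop
      (𝓝 (‖conjPoisson ε f x‖ₑ ^ p)) := by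
    intro x
    refine (ENNReal.continuous_rpow_const.tendsto _).comp (Tendsto.enorm ?_)
    refine tendsto_integral_of_dominated_convergence (fun t => 1 / ε * ‖f t‖)
      (fun n => (integrable_conjKernel_smul (hfi n) hε x).aestronglyMeasurable)
      (hf.norm.const_mul _) (fun n => Eventually.of_forall fun t => ?_)
      (Eventually.of_forall fun t => ?_)
    · rw [norm_smul]
      exact mul_le_mul (norm_conjKernel_le hε _) (norm_indicator_le_norm_self _ _)
        (norm_nonneg _) (by positivity)
    · refine tendsto_const_nhds.congr' ?_
      obtain ⟨N, hN⟩ := exists_nat_ge |t|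
      filter_upwards [eventually_ge_atTop N] with n hn
      have : t ∈ Set.Icc (-n : ℝ) n := by
        rw [Set.mem_Icc, ← abs_le]
        exact hN.trans (by exact_mod_cast hn)
      rw [Set.indicator_of_mem this]
  calc ∫⁻ x, ‖conjPoisson ε f x‖ₑ ^ p
      = ∫⁻ x, liminf
          (fun n : ℕ => ‖conjPoisson ε ((Set.Icc (-n : ℝ) n).indicator f) x‖ₑ ^ p) atTop :=
        lintegral_congr fun x => (hlim x).liminf_eq.symm
    _ ≤ liminf (fun n : ℕ =>
          ∫⁻ x, ‖conjPoisson ε ((Set.Icc (-n : ℝ) n).indicator f) x‖ₑ ^ p) atTop :=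
        lintegral_liminf_le fun n =>
          (continuous_conjPoisson (hfi n) hε).enorm.measurable.pow_const p
    _ ≤ C := by
        refine liminf_le_of_le (by isBoundedDefault) fun b hb => ?_
        obtain ⟨n, hn⟩ := hb.exists
        exact hn.trans (h n)

end

theorem halfPlaneExtension_im_eq_conjPoisson {f : ℝ → ℝ} (hf : Integrable f) (x : ℝ) {ε : ℝ}
    (hε : 0 < ε) : (halfPlaneExtension f (x + ε * Complex.I)).im = conjPoisson ε f x := by
  rw [halfPlaneExtension_im hf x hε, conjPoisson]
  exact integral_congr_ae (Eventually.of_forall fun t => by simp [conjKernel, mul_comm])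

/-- M. Riesz's bound for a nonnegative function with bounded support. The inequality `hAB` is applied
to the analytic extension on the line of height `ε` and integrated over `[-n, n]`; as `n → ∞` the
integral of the analytic function `w ^ p` tends to zero. -/
theorem lintegral_conjPoisson_rpow_le_of_compactSupport {p : ℝ} (hp : 1 < p) {A B : ℝ}
    (hA : 0 ≤ A) (hB : 0 ≤ B)
    (hAB : ∀ w : ℂ, 0 < w.re → |w.im| ^ p ≤ A * w.re ^ p - B * (w ^ (p : ℂ)).re)
    {f : ℝ → ℝ} (hfm : Measurable f) (hf : Integrable f) (h0 : ∀ t, 0 ≤ f t) {M : ℝ}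
    (hM : ∀ t, M < |t| → f t = 0) {ε : ℝ} (hε : 0 < ε) :
    ∫⁻ x, ‖conjPoisson ε f x‖ₑ ^ p ≤
      ENNReal.ofReal A * (ENNReal.ofReal Real.pi ^ p * ∫⁻ t, ENNReal.ofReal (f t) ^ p) := by
  have hp0 : 0 ≤ p := by linarith
  -- a null function is set aside, since its extension does not lie in the open half-plane
  by_cases hf0 : f =ᵐ[volume] 0
  · have : ∀ x, conjPoisson ε f x = 0 := fun x => by
      refine integral_eq_zero_of_ae ?_
      filter_upwards [hf0] with t ht
      simp [ht]
    simp [this, ENNReal.zero_rpow_of_pos (by linarith : 0 < p)]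
  have hpos : ∀ z : ℂ, 0 < z.im → 0 < (halfPlaneExtension f z).re := by
    intro z hz
    rw [← Complex.re_add_im z, halfPlaneExtension_re hf _ hz]
    have hk : ∀ t : ℝ, 0 < z.im / ((z.re - t) ^ 2 + z.im ^ 2) := fun t => by positivity
    have hnn : ∀ t : ℝ, 0 ≤ f t * (z.im / ((z.re - t) ^ 2 + z.im ^ 2)) := fun t =>
      mul_nonneg (h0 t) (hk t).le
    refine lt_of_le_of_ne (integral_nonneg hnn) fun h => hf0 ?_
    have hint : Integrable fun t => f t * (z.im / ((z.re - t) ^ 2 + z.im ^ 2)) :=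
      hf.mul_bdd (c := 1 / z.im) (Measurable.aestronglyMeasurable (by fun_prop))
        (Eventually.of_forall fun t => by
          rw [Real.norm_of_nonneg (hk t).le, div_le_div_iff₀ (by positivity) hz]
          nlinarith [sq_nonneg (z.re - t)])
    filter_upwards [(integral_eq_zero_iff_of_nonneg hnn hint).1 h.symm] with t ht
    exact (mul_eq_zero.1 ht).resolve_right (hk t).ne'
  set F : ℝ → ℂ := fun x => halfPlaneExtension f (x + ε * Complex.I) with hF
  have hFpos : ∀ x, 0 < (F x).re := fun x => hpos _ (by simpa using hε)
  have hFc : Continuous F := by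
    refine continuous_iff_continuousAt.2 fun x => ?_
    refine ContinuousAt.comp (g := halfPlaneExtension f)
      (differentiableAt_halfPlaneExtension hf (by simpa using hε)).continuousAt ?_
    fun_prop
  have hc1 : Continuous fun x => |(F x).im| ^ p :=
    (Complex.continuous_im.comp hFc).abs.rpow_const fun x => Or.inr hp0
  have hc2 : Continuous fun x => (F x).re ^ p :=
    (Complex.continuous_re.comp hFc).rpow_const fun x => Or.inr hp0
  have hc3 : Continuous fun x => F x ^ (p : ℂ) :=
    hFc.cpow continuous_const fun x => Or.inl (hFpos x)
  have hc4 : Continuous fun x => (F x ^ (p : ℂ)).re := Complex.continuous_re.comp hc3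
  set K := 2 * ∫ t, ‖f t‖ with hK
  have hK0 : 0 ≤ K := mul_nonneg zero_le_two (integral_nonneg fun _ => norm_nonneg _)
  set S := ∫⁻ x, ENNReal.ofReal ((F x).re) ^ p with hS
  have hSle : S ≤ ENNReal.ofReal Real.pi ^ p * ∫⁻ t, ENNReal.ofReal (f t) ^ p := by
    refine le_trans (le_of_eq (lintegral_congr fun x => ?_))
      (lintegral_poisson_rpow_le hfm hf h0 hp hε)
    rw [hF, halfPlaneExtension_re hf x hε]
  have hstep : ∀ n : ℕ, 0 < n → 2 * M ≤ n →
      ∫⁻ x in Set.Icc (-n : ℝ) n, ‖conjPoisson ε f x‖ₑ ^ p ≤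
        ENNReal.ofReal A * S + ENNReal.ofReal (B * (4 * n * (K / n) ^ p)) := by
    intro n hn hnM
    have hn' : (0 : ℝ) < n := by exact_mod_cast hn
    have hle : (-n : ℝ) ≤ n := by linarith
    have hmain : ∫ x in (-n : ℝ)..n, |(F x).im| ^ p ≤
        A * (∫ x in (-n : ℝ)..n, (F x).re ^ p) + B * (4 * n * (K / n) ^ p) := by
      have h1 : ∫ x in (-n : ℝ)..n, |(F x).im| ^ p ≤
          ∫ x in (-n : ℝ)..n, (A * (F x).re ^ p - B * (F x ^ (p : ℂ)).re) := by
        refine intervalIntegral.integral_mono_on hle (hc1.intervalIntegrable _ _)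
          (((hc2.const_mul A).sub (hc4.const_mul B)).intervalIntegrable _ _)
          fun x _ => hAB _ (hFpos x)
      have h2 : ∫ x in (-n : ℝ)..n, (A * (F x).re ^ p - B * (F x ^ (p : ℂ)).re) =
          A * (∫ x in (-n : ℝ)..n, (F x).re ^ p) -
            B * (∫ x in (-n : ℝ)..n, F x ^ (p : ℂ)).re := by
        have h3 := Complex.reCLM.intervalIntegral_comp_comm (hc3.intervalIntegrable (μ := volume) (-n : ℝ) n)
        simp only [Complex.reCLM_apply] at h3
        rw [intervalIntegral.integral_sub ((hc2.const_mul A).intervalIntegrable _ _)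
          ((hc4.const_mul B).intervalIntegrable _ _),
          intervalIntegral.integral_const_mul, intervalIntegral.integral_const_mul]
        rw [← h3]
      have h4 := norm_integral_halfPlaneExtension_cpow_le hf hM hpos hp hε hn' hnM
      have h5 := (Complex.abs_re_le_norm (∫ x in (-n : ℝ)..n, F x ^ (p : ℂ))).trans h4
      have h6 := mul_le_mul_of_nonneg_left ((neg_le_abs _).trans h5) hB
      linarith
    have hl : ∫⁻ x in Set.Icc (-n : ℝ) n, ‖conjPoisson ε f x‖ₑ ^ p =
        ENNReal.ofReal (∫ x in (-n : ℝ)..n, |(F x).im| ^ p) := by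
      rw [intervalIntegral.integral_of_le hle, ← integral_Icc_eq_integral_Ioc,
        ofReal_integral_eq_lintegral_ofReal (hc1.integrableOn_Icc)
          (Eventually.of_forall fun x => by positivity)]
      refine lintegral_congr fun x => ?_
      rw [← halfPlaneExtension_im_eq_conjPoisson hf x hε, ← ENNReal.ofReal_rpow_of_nonneg
        (abs_nonneg _) hp0, Real.enorm_eq_ofReal_abs]
    have hr : ENNReal.ofReal (∫ x in (-n : ℝ)..n, (F x).re ^ p) ≤ S := by
      rw [intervalIntegral.integral_of_le hle, ← integral_Icc_eq_integral_Ioc,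
        ofReal_integral_eq_lintegral_ofReal (hc2.integrableOn_Icc)
          (Eventually.of_forall fun x => Real.rpow_nonneg (hFpos x).le _)]
      refine (setLIntegral_le_lintegral _ _).trans (le_of_eq (lintegral_congr fun x => ?_))
      rw [ENNReal.ofReal_rpow_of_nonneg (hFpos x).le hp0]
    rw [hl]
    refine (ENNReal.ofReal_le_ofReal hmain).trans ?_
    refine ENNReal.ofReal_add_le.trans ?_
    gcongr
    rw [ENNReal.ofReal_mul hA]
    gcongr
  have hlimL : Tendsto (fun n : ℕ => ∫⁻ x in Set.Icc (-n : ℝ) n, ‖conjPoisson ε f x‖ₑ ^ p) atTop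
      (𝓝 (∫⁻ x, ‖conjPoisson ε f x‖ₑ ^ p)) :=
    (aecover_Icc (tendsto_neg_atTop_atBot.comp tendsto_natCast_atTop_atTop)
      tendsto_natCast_atTop_atTop).lintegral_tendsto_of_nat
      ((continuous_conjPoisson hf hε).enorm.measurable.pow_const p).aemeasurable
  have hlimE : Tendsto (fun n : ℕ => B * (4 * (n : ℝ) * (K / n) ^ p)) atTop (𝓝 0) := by
    have h1 : Tendsto (fun n : ℕ => B * (4 * (K ^ p * (n : ℝ) ^ (-(p - 1))))) atTop
        (𝓝 (B * (4 * (K ^ p * 0)))) :=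
      ((((tendsto_rpow_neg_atTop (by linarith : 0 < p - 1)).comp
        tendsto_natCast_atTop_atTop).const_mul _).const_mul _).const_mul _
    simp only [mul_zero] at h1
    refine h1.congr' ?_
    filter_upwards [eventually_gt_atTop 0] with n hn
    have hn' : (0 : ℝ) < n := by exact_mod_cast hn
    rw [Real.div_rpow hK0 hn'.le, neg_sub, Real.rpow_sub hn', Real.rpow_one]
    ring
  have hlimR : Tendsto (fun n : ℕ => ENNReal.ofReal A * S +
      ENNReal.ofReal (B * (4 * n * (K / n) ^ p))) atTop (𝓝 (ENNReal.ofReal A * S + 0)) := by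
    refine tendsto_const_nhds.add ?_
    have := ENNReal.tendsto_ofReal hlimE
    rwa [ENNReal.ofReal_zero] at this
  have hfin : ∫⁻ x, ‖conjPoisson ε f x‖ₑ ^ p ≤ ENNReal.ofReal A * S + 0 := by
    refine le_of_tendsto_of_tendsto hlimL hlimR ?_
    obtain ⟨N, hN⟩ := exists_nat_ge (2 * M)
    filter_upwards [eventually_gt_atTop 0, eventually_ge_atTop N] with n hn hnN
    exact hstep n hn (hN.trans (by exact_mod_cast hnN))
  rw [add_zero] at hfin
  exact hfin.trans (by gcongr)

theorem lintegral_rpow_le_of_le_add {α : Type*} [MeasurableSpace α] {μ : Measure α}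
    {h a b : α → ℝ≥0∞} (ha : Measurable a) (hb : Measurable b) (hle : ∀ x, h x ≤ a x + b x)
    {p : ℝ} (hp : 1 ≤ p) {D : ℝ≥0∞} (hDa : ∫⁻ x, a x ^ p ∂μ ≤ D) (hDb : ∫⁻ x, b x ^ p ∂μ ≤ D) :
    ∫⁻ x, h x ^ p ∂μ ≤ 2 ^ (p - 1) * (2 * D) := by
  calc ∫⁻ x, h x ^ p ∂μ ≤ ∫⁻ x, 2 ^ (p - 1) * (a x ^ p + b x ^ p) ∂μ :=
        lintegral_mono fun x => (ENNReal.rpow_le_rpow (hle x) (by linarith)).trans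
          (ENNReal.rpow_add_le_mul_rpow_add_rpow _ _ hp)
    _ = 2 ^ (p - 1) * ((∫⁻ x, a x ^ p ∂μ) + ∫⁻ x, b x ^ p ∂μ) := by
        rw [lintegral_const_mul _ (by fun_prop), lintegral_add_left (by fun_prop)]
    _ ≤ 2 ^ (p - 1) * (2 * D) := by
        rw [two_mul]
        gcongr

/-- The bound for integrable complex functions and `1 < p ≤ 2`, by splitting into the positive and
negative parts of the real and imaginary part. -/
theorem exists_lintegral_conjPoisson_rpow_le_of_le_two {p : ℝ} (hp : 1 < p) (hp2 : p ≤ 2) :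
    ∃ C : ℝ≥0∞, C ≠ ∞ ∧ ∀ (f : ℝ → ℂ), Measurable f → Integrable f → ∀ ε : ℝ, 0 < ε →
      ∫⁻ x, ‖conjPoisson ε f x‖ₑ ^ p ≤ C * ∫⁻ t, ‖f t‖ₑ ^ p := by
  obtain ⟨A, B, hA, hB, hAB⟩ := exists_abs_im_rpow_le hp hp2
  have hp0 : 0 < p := by linarith
  set D : ℝ≥0∞ := ENNReal.ofReal A * ENNReal.ofReal Real.pi ^ p with hD
  have hDtop : D ≠ ∞ := ENNReal.mul_ne_top ENNReal.ofReal_ne_top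
    (ENNReal.rpow_ne_top_of_nonneg hp0.le ENNReal.ofReal_ne_top)
  -- nonnegative functions
  have hnn : ∀ f : ℝ → ℝ, Measurable f → Integrable f → (∀ t, 0 ≤ f t) → ∀ ε : ℝ, 0 < ε →
      ∫⁻ x, ‖conjPoisson ε f x‖ₑ ^ p ≤ D * ∫⁻ t, ENNReal.ofReal (f t) ^ p := by
    intro f hfm hf h0 ε hε
    refine lintegral_conjPoisson_le_of_indicator hf hε fun n => ?_
    refine (lintegral_conjPoisson_rpow_le_of_compactSupport hp hA hB hAB (M := n)
      (hfm.indicator measurableSet_Icc) (hf.indicator measurableSet_Icc)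
      (fun t => Set.indicator_nonneg (fun t _ => h0 t) t) (fun t ht => ?_) hε).trans ?_
    · refine Set.indicator_of_notMem (fun h => ?_) _
      rw [Set.mem_Icc, ← abs_le] at h
      linarith
    · rw [← mul_assoc]
      refine mul_le_mul_right (lintegral_mono fun t => ?_) D
      refine ENNReal.rpow_le_rpow (ENNReal.ofReal_le_ofReal ?_) hp0.le
      exact Set.indicator_le_self' (fun t _ => h0 t) t
  -- real functions, as the difference of the positive and the negative part
  set c : ℝ≥0∞ := 2 ^ (p - 1) with hc
  have hctop : c ≠ ∞ := ENNReal.rpow_ne_top_of_nonneg (by linarith) (by simp)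
  have hreal : ∀ f : ℝ → ℝ, Measurable f → Integrable f → ∀ ε : ℝ, 0 < ε →
      ∫⁻ x, ‖conjPoisson ε f x‖ₑ ^ p ≤ c * (2 * D) * ∫⁻ t, ‖f t‖ₑ ^ p := by
    intro f hfm hf ε hε
    have hpm : Measurable fun t => max (f t) 0 := by fun_prop
    have hnm : Measurable fun t => max (-f t) 0 := by fun_prop
    have hpi : Integrable fun t => max (f t) 0 := hf.pos_part
    have hni : Integrable fun t => max (-f t) 0 := hf.neg_part
    have h1 := hnn _ hpm hpi (fun t => le_max_right _ _) ε hε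
    have h2 := hnn _ hnm hni (fun t => le_max_right _ _) ε hε
    have hsub : ∀ x, conjPoisson ε f x =
        conjPoisson ε (fun t => max (f t) 0) x - conjPoisson ε (fun t => max (-f t) 0) x := by
      intro x
      rw [← conjPoisson_sub hpi hni hε]
      congr 1
      funext t
      rcases le_total 0 (f t) with h | h
      · rw [max_eq_left h, max_eq_right (by linarith), sub_zero]
      · rw [max_eq_right h, max_eq_left (by linarith)]; ring
    have hle : ∀ t, ENNReal.ofReal (max (f t) 0) ^ p ≤ ‖f t‖ₑ ^ p := fun t => by
      rw [Real.enorm_eq_ofReal_abs]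
      exact ENNReal.rpow_le_rpow (ENNReal.ofReal_le_ofReal
        (max_le (le_abs_self _) (abs_nonneg _))) hp0.le
    have hle' : ∀ t, ENNReal.ofReal (max (-f t) 0) ^ p ≤ ‖f t‖ₑ ^ p := fun t => by
      rw [Real.enorm_eq_ofReal_abs]
      exact ENNReal.rpow_le_rpow (ENNReal.ofReal_le_ofReal
        (max_le (neg_le_abs _) (abs_nonneg _))) hp0.le
    have h3 := lintegral_rpow_le_of_le_add (continuous_conjPoisson hpi hε).enorm.measurable
      (continuous_conjPoisson hni hε).enorm.measurable
      (fun x => (hsub x ▸ enorm_sub_le : ‖conjPoisson ε f x‖ₑ ≤ _)) hp.le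
      (h1.trans (mul_le_mul_right (lintegral_mono hle) D))
      (h2.trans (mul_le_mul_right (lintegral_mono hle') D))
    exact h3.trans (le_of_eq (by ring))
  refine ⟨c * (2 * (c * (2 * D))), by finiteness, fun f hfm hf ε hε => ?_⟩
  have hrm : Measurable fun t => (f t).re := by fun_prop
  have him : Measurable fun t => (f t).im := by fun_prop
  have hri : Integrable fun t => (f t).re := hf.re
  have hii : Integrable fun t => (f t).im := hf.im
  have hle : ∀ t, ‖(f t).re‖ₑ ^ p ≤ ‖f t‖ₑ ^ p := fun t =>
    ENNReal.rpow_le_rpow (enorm_le_iff_norm_le.2 (Complex.abs_re_le_norm _)) hp0.le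
  have hle' : ∀ t, ‖(f t).im‖ₑ ^ p ≤ ‖f t‖ₑ ^ p := fun t =>
    ENNReal.rpow_le_rpow (enorm_le_iff_norm_le.2 (Complex.abs_im_le_norm _)) hp0.le
  have hsplit : ∀ x, ‖conjPoisson ε f x‖ₑ ≤
      ‖conjPoisson ε (fun t => (f t).re) x‖ₑ + ‖conjPoisson ε (fun t => (f t).im) x‖ₑ := by
    intro x
    have hi := integrable_conjKernel_smul hf hε x
    have e1 : conjPoisson ε (fun t => (f t).re) x = (conjPoisson ε f x).re := by
      refine Eq.trans ?_ (integral_re hi)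
      simp [conjPoisson]
    have e2 : conjPoisson ε (fun t => (f t).im) x = (conjPoisson ε f x).im := by
      refine Eq.trans ?_ (integral_im hi)
      simp [conjPoisson]
    rw [e1, e2, ← ofReal_norm, ← ofReal_norm, ← ofReal_norm,
      ← ENNReal.ofReal_add (norm_nonneg _) (norm_nonneg _)]
    exact ENNReal.ofReal_le_ofReal (Complex.norm_le_abs_re_add_abs_im _)
  have h3 := lintegral_rpow_le_of_le_add (continuous_conjPoisson hri hε).enorm.measurable
    (continuous_conjPoisson hii hε).enorm.measurable hsplit hp.le
    ((hreal _ hrm hri ε hε).trans (mul_le_mul_right (lintegral_mono hle) _))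
    ((hreal _ him hii ε hε).trans (mul_le_mul_right (lintegral_mono hle') _))
  exact h3.trans (le_of_eq (by ring))

/-! ### Duality, for exponents at least two -/

/-- The conjugate Poisson integral is antisymmetric for the bilinear pairing, since its kernel is
odd. -/
theorem integral_conjPoisson_mul {f g : ℝ → ℂ} (hf : Integrable f) (hg : Integrable g) {ε : ℝ}
    (hε : 0 < ε) :
    ∫ x, conjPoisson ε f x * g x = -∫ t, f t * conjPoisson ε g t := by
  have hint : Integrable (Function.uncurry fun x t : ℝ => conjKernel ε (x - t) • (g x * f t))
      (volume.prod volume) := by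
    refine (hg.mul_prod hf).bdd_smul (1 / ε)
      (φ := fun z : ℝ × ℝ => conjKernel ε (z.1 - z.2)) ?_ ?_
    · exact Measurable.aestronglyMeasurable ((measurable_conjKernel ε).comp (by fun_prop))
    · exact Eventually.of_forall fun z => norm_conjKernel_le hε _
  have h1 : ∀ x, conjPoisson ε f x * g x = ∫ t, conjKernel ε (x - t) • (g x * f t) := fun x => by
    rw [conjPoisson, ← integral_mul_const]
    refine integral_congr_ae (Eventually.of_forall fun t => ?_)
    change conjKernel ε (x - t) • f t * g x = _
    rw [smul_mul_assoc, mul_comm (f t)]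
  have h2 : ∀ t, -(f t * conjPoisson ε g t) = ∫ x, conjKernel ε (x - t) • (g x * f t) :=
    fun t => by
    rw [conjPoisson, ← integral_const_mul, ← integral_neg]
    refine integral_congr_ae (Eventually.of_forall fun x => ?_)
    change -(f t * conjKernel ε (t - x) • g x) = conjKernel ε (x - t) • (g x * f t)
    rw [← neg_sub x t, conjKernel_neg, neg_smul, mul_neg, neg_neg, mul_smul_comm, mul_comm]
  simp_rw [h1]
  rw [integral_integral_swap hint, ← integral_neg]
  simp_rw [h2]

/-- The absorption step of a duality argument: a finite `S` on the right-hand side, with exponent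
`1 / q`, is divided out. -/
theorem ENNReal.le_mul_of_le_rpow_mul {p q : ℝ} (hpq : p.HolderConjugate q) {S N C : ℝ≥0∞}
    (hS : S ≠ ∞) (h : S ≤ N ^ (1 / p) * (C * S) ^ (1 / q)) : S ≤ C ^ (p - 1) * N := by
  have hp := hpq.pos
  have hq := hpq.symm.pos
  rcases eq_or_ne S 0 with h0 | h0
  · simp [h0]
  have e : S = S ^ (1 / p) * S ^ (1 / q) := by
    rw [← ENNReal.rpow_add _ _ h0 hS, one_div, one_div, hpq.inv_add_inv_eq_one, ENNReal.rpow_one]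
  have hSq0 : S ^ (1 / q) ≠ 0 := (ENNReal.rpow_pos (pos_iff_ne_zero.2 h0) hS).ne'
  have hSq : S ^ (1 / q) ≠ ∞ := ENNReal.rpow_ne_top_of_nonneg (by positivity) hS
  rw [ENNReal.mul_rpow_of_nonneg _ _ (by positivity), ← mul_assoc] at h
  conv_lhs at h => rw [e]
  have h2 := (ENNReal.mul_le_mul_iff_left hSq0 hSq).1 h
  have h3 := ENNReal.rpow_le_rpow h2 hp.le
  rw [ENNReal.mul_rpow_of_nonneg _ _ hp.le, ← ENNReal.rpow_mul, ← ENNReal.rpow_mul,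
    ← ENNReal.rpow_mul, one_div_mul_cancel hp.ne', ENNReal.rpow_one, ENNReal.rpow_one, mul_comm] at h3
  convert! h3 using 3
  have := hpq.sub_one_mul_conj
  field_simp
  linarith

/-- The conjugate Poisson integrals are bounded on `L ^ p`, `1 < p < ∞`, uniformly in `ε`. For
`p ≥ 2` the function `h = conjPoisson ε f` is tested on bounded intervals against
`conj h * |h| ^ (p - 2)`, and the bound for the conjugate exponent is applied. -/
theorem exists_lintegral_conjPoisson_rpow_le {p : ℝ} (hp : 1 < p) :
    ∃ C : ℝ≥0∞, C ≠ ∞ ∧ ∀ (f : ℝ → ℂ), Measurable f → Integrable f → ∀ ε : ℝ, 0 < ε →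
      ∫⁻ x, ‖conjPoisson ε f x‖ₑ ^ p ≤ C * ∫⁻ t, ‖f t‖ₑ ^ p := by
  rcases le_total p 2 with hp2 | hp2
  · exact exists_lintegral_conjPoisson_rpow_le_of_le_two hp hp2
  obtain ⟨q, hpq⟩ : ∃ q, p.HolderConjugate q := ⟨_, Real.HolderConjugate.conjExponent hp⟩
  have hp0 := hpq.pos
  have hq1 : 1 < q := hpq.symm.lt
  have hq2 : q ≤ 2 := by
    have := hpq.sub_one_mul_conj
    nlinarith
  obtain ⟨C, hC, hCq⟩ := exists_lintegral_conjPoisson_rpow_le_of_le_two hq1 hq2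
  refine ⟨C ^ (p - 1), ENNReal.rpow_ne_top_of_nonneg (by linarith) hC, fun f hfm hf ε hε => ?_⟩
  set h : ℝ → ℂ := conjPoisson ε f with hh
  have hc : Continuous h := continuous_conjPoisson hf hε
  -- the test function dual to `h` on the interval `[-n, n]`
  have hstep : ∀ n : ℕ, ∫⁻ x in Set.Icc (-n : ℝ) n, ‖h x‖ₑ ^ p ≤
      C ^ (p - 1) * ∫⁻ t, ‖f t‖ₑ ^ p := by
    intro n
    set I := Set.Icc (-n : ℝ) n with hI
    set g : ℝ → ℂ := I.indicator fun x => star (h x) * (‖h x‖ ^ (p - 2) : ℝ) with hg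
    have hgc : Continuous fun x => star (h x) * ((‖h x‖ ^ (p - 2) : ℝ) : ℂ) :=
      hc.star.mul (Complex.continuous_ofReal.comp
        (hc.norm.rpow_const fun x => Or.inr (by linarith)))
    have hgm : Measurable g := hgc.measurable.indicator measurableSet_Icc
    have hgi : Integrable g :=
      (integrable_indicator_iff measurableSet_Icc).2 hgc.integrableOn_Icc
    set S := ∫⁻ x in I, ‖h x‖ₑ ^ p with hS
    have hpc : Continuous fun x => ‖h x‖ ^ p := hc.norm.rpow_const fun x => Or.inr hp0.le
    have hSeq : S = ENNReal.ofReal (∫ x in I, ‖h x‖ ^ p) := by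
      rw [ofReal_integral_eq_lintegral_ofReal hpc.integrableOn_Icc
        (Eventually.of_forall fun x => by positivity)]
      refine lintegral_congr fun x => ?_
      rw [← ENNReal.ofReal_rpow_of_nonneg (norm_nonneg _) hp0.le, ofReal_norm]
    have hpair : ∀ x, h x * g x = ((I.indicator (fun x => ‖h x‖ ^ p) x : ℝ) : ℂ) := by
      intro x
      by_cases hx : x ∈ I
      · rw [hg, Set.indicator_of_mem hx, Set.indicator_of_mem hx, ← mul_assoc]
        rw [show h x * star (h x) = ((‖h x‖ ^ 2 : ℝ) : ℂ) by
          rw [Complex.star_def, Complex.mul_conj, Complex.normSq_eq_norm_sq], ← Complex.ofReal_mul]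
        congr 1
        rcases (norm_nonneg (h x)).eq_or_lt with h0 | h0
        · rw [← h0, Real.zero_rpow hp0.ne']; simp
        · rw [← Real.rpow_natCast, ← Real.rpow_add h0]
          congr 1
          push_cast
          ring
      · simp [hg, hx]
    have hgq : ∫⁻ x, ‖g x‖ₑ ^ q = S := by
      rw [hS, ← lintegral_indicator measurableSet_Icc]
      refine lintegral_congr fun x => ?_
      by_cases hx : x ∈ I
      · rw [hg, Set.indicator_of_mem hx, Set.indicator_of_mem hx, ← ofReal_norm, ← ofReal_norm,
          ENNReal.ofReal_rpow_of_nonneg (norm_nonneg _) hpq.symm.nonneg,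
          ENNReal.ofReal_rpow_of_nonneg (norm_nonneg _) hp0.le]
        congr 1
        rw [norm_mul, norm_star, Complex.norm_real, Real.norm_of_nonneg (by positivity)]
        rcases (norm_nonneg (h x)).eq_or_lt with h0 | h0
        · rw [← h0, zero_mul, Real.zero_rpow hp0.ne', Real.zero_rpow hpq.symm.pos.ne']
        · conv_lhs => rw [← Real.rpow_one ‖h x‖, ← Real.rpow_mul h0.le, one_mul,
            ← Real.rpow_add h0, ← Real.rpow_mul h0.le]
          congr 1
          have := hpq.sub_one_mul_conj
          linarith
      · rw [hg, Set.indicator_of_notMem hx, Set.indicator_of_notMem hx, enorm_zero,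
          ENNReal.zero_rpow_of_pos hpq.symm.pos]
    have hSle : S ≤ (∫⁻ t, ‖f t‖ₑ ^ p) ^ (1 / p) * (C * S) ^ (1 / q) := by
      calc S = ‖∫ x, h x * g x‖ₑ := by
            simp_rw [hpair]
            rw [integral_complex_ofReal, integral_indicator measurableSet_Icc, hSeq, ← ofReal_norm,
              Complex.norm_real, Real.norm_of_nonneg (integral_nonneg fun x => by positivity)]
        _ = ‖∫ t, f t * conjPoisson ε g t‖ₑ := by
            rw [hh, integral_conjPoisson_mul hf hgi hε, enorm_neg]
        _ ≤ ∫⁻ t, ‖f t‖ₑ * ‖conjPoisson ε g t‖ₑ := by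
            refine (enorm_integral_le_lintegral_enorm _).trans (le_of_eq ?_)
            simp_rw [enorm_mul]
        _ ≤ (∫⁻ t, ‖f t‖ₑ ^ p) ^ (1 / p) * (∫⁻ t, ‖conjPoisson ε g t‖ₑ ^ q) ^ (1 / q) :=
            ENNReal.lintegral_mul_le_Lp_mul_Lq volume hpq hfm.enorm.aemeasurable
              (continuous_conjPoisson hgi hε).enorm.measurable.aemeasurable
        _ ≤ _ := by
            have h4 := hCq g hgm hgi ε hε
            rw [hgq] at h4
            have := hpq.symm.pos
            gcongr
    exact ENNReal.le_mul_of_le_rpow_mul hpq (hSeq ▸ ENNReal.ofReal_ne_top) hSle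
  have hlim : Tendsto (fun n : ℕ => ∫⁻ x in Set.Icc (-n : ℝ) n, ‖h x‖ₑ ^ p) atTop
      (𝓝 (∫⁻ x, ‖h x‖ₑ ^ p)) :=
    (aecover_Icc (tendsto_neg_atTop_atBot.comp tendsto_natCast_atTop_atTop)
      tendsto_natCast_atTop_atTop).lintegral_tendsto_of_nat
      (hc.enorm.measurable.pow_const p).aemeasurable
  exact le_of_tendsto' hlim hstep

/-! ### Hilbert transforms along a direction -/

section

variable {E : Type*} [NormedAddCommGroup E] [InnerProductSpace ℝ E]

/-- The Hilbert transform of `g` along `z` (without the factor `1 / π`), with the principal value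
folded into an integral over the half-line. -/
noncomputable def dirHilbert (g : E → ℂ) (z x : E) : ℂ :=
  ∫ s in Set.Ioi (0 : ℝ), s⁻¹ • (g (x - s • z) - g (x + s • z))

/-- The regularization of `dirHilbert` with the conjugate Poisson kernel. -/
noncomputable def dirConjPoisson (ε : ℝ) (g : E → ℂ) (z x : E) : ℂ :=
  ∫ s in Set.Ioi (0 : ℝ), conjKernel ε s • (g (x - s • z) - g (x + s • z))

/-- On a line parallel to `z` the regularized directional transform is the one-dimensional conjugate
Poisson integral. -/
theorem dirConjPoisson_line {g : E → ℂ} {z v : E} (hg : Integrable fun t : ℝ => g (v + t • z))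
    {ε : ℝ} (hε : 0 < ε) (τ : ℝ) :
    dirConjPoisson ε g z (v + τ • z) = conjPoisson ε (fun t : ℝ => g (v + t • z)) τ := by
  set h : ℝ → ℂ := fun t => g (v + t • z) with hh
  have hi : Integrable fun s => conjKernel ε s • h (τ - s) := by
    have := (integrable_conjKernel_smul hg hε τ).comp_sub_left τ
    simpa using this
  have hi' : Integrable fun s => conjKernel ε s • h (τ + s) := by
    have := hi.comp_neg.neg
    refine this.congr (Eventually.of_forall fun s => ?_)
    simp [conjKernel_neg]
  have e1 : conjPoisson ε h τ = ∫ s, conjKernel ε s • h (τ - s) := by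
    rw [conjPoisson, ← integral_sub_left_eq_self _ volume τ]
    simp
  rw [e1, ← intervalIntegral.integral_Iic_add_Ioi (b := 0) hi.integrableOn hi.integrableOn]
  have e2 : ∫ s in Set.Iic (0 : ℝ), conjKernel ε s • h (τ - s) =
      -∫ s in Set.Ioi (0 : ℝ), conjKernel ε s • h (τ + s) := by
    have := integral_comp_neg_Ioi 0 fun s => conjKernel ε s • h (τ - s)
    rw [neg_zero] at this
    rw [← this, ← integral_neg]
    simp [conjKernel_neg]
  rw [e2, neg_add_eq_sub, ← integral_sub hi.integrableOn hi'.integrableOn, dirConjPoisson]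
  refine integral_congr_ae (Eventually.of_forall fun s => ?_)
  simp only [hh, ← smul_sub]
  congr 3 <;> module

variable [MeasurableSpace E] [BorelSpace E]

theorem measurable_dirConjPoisson {g : E → ℂ} (hg : Continuous g) {ε : ℝ} (hε : 0 < ε) (z : E) :
    Measurable (dirConjPoisson ε g z) := by
  have hk := continuous_conjKernel hε
  refine (StronglyMeasurable.integral_prod_right
    (f := fun (x : E) (s : ℝ) => conjKernel ε s • (g (x - s • z) - g (x + s • z)))
    ?_).measurable
  have : Continuous (Function.uncurry
      fun (x : E) (s : ℝ) => conjKernel ε s • (g (x - s • z) - g (x + s • z))) := by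
    unfold Function.uncurry
    fun_prop
  exact this.stronglyMeasurable

variable [FiniteDimensional ℝ E]

/-- Integration over the lines parallel to `z`: Lebesgue measure is, up to a constant, the product
of a Haar measure on the orthogonal complement of `z` and Lebesgue measure on the lines. -/
theorem exists_lintegral_eq_lintegral_lines {z : E} (hz : z ≠ 0) :
    ∃ (c : ℝ≥0∞) (ν : Measure (ℝ ∙ z)ᗮ), c ≠ 0 ∧ SFinite ν ∧
      ∀ Φ : E → ℝ≥0∞, Measurable Φ →
        ∫⁻ x, Φ x = c * ∫⁻ v, (∫⁻ τ : ℝ, Φ (v + τ • z)) ∂ν := by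
  set K := (ℝ ∙ z)ᗮ with hK
  let L₀ : (K × ℝ) ≃ₗ[ℝ] E :=
    ((LinearEquiv.refl ℝ K).prodCongr (LinearEquiv.toSpanNonzeroSingleton ℝ E z hz)).trans
      (Submodule.prodEquivOfIsCompl _ _ (Submodule.isCompl_orthogonal (K := ℝ ∙ z)).symm)
  let L : (K × ℝ) ≃L[ℝ] E := L₀.toContinuousLinearEquiv
  have hL : ∀ y : K × ℝ, L y = (y.1 : E) + y.2 • z := fun y => by
    change L₀ y = _
    simp [L₀]
  let ν : Measure K := Measure.addHaar
  have hH : (Measure.map L (ν.prod volume)).IsAddHaarMeasure :=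
    L.isAddHaarMeasure_map (ν.prod volume)
  refine ⟨Measure.addHaarScalarFactor volume (Measure.map L (ν.prod volume)), ν, ?_,
    inferInstance, fun Φ hΦ => ?_⟩
  · exact_mod_cast (Measure.addHaarScalarFactor_pos_of_isAddHaarMeasure _ _).ne'
  · have hm : Measurable L := L.continuous.measurable
    conv_lhs => rw [Measure.isAddLeftInvariant_eq_smul volume (Measure.map L (ν.prod volume))]
    rw [lintegral_smul_measure, lintegral_map hΦ hm,
      lintegral_prod (fun y => Φ (L y)) (hΦ.comp hm).aemeasurable]
    simp only [hL]
    rfl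

theorem lintegral_dirConjPoisson_rpow_le {p : ℝ} {C : ℝ≥0∞}
    (hC : ∀ f : ℝ → ℂ, Measurable f → Integrable f → ∀ ε : ℝ, 0 < ε →
      ∫⁻ x, ‖conjPoisson ε f x‖ₑ ^ p ≤ C * ∫⁻ t, ‖f t‖ₑ ^ p)
    {g : E → ℂ} (hg : Continuous g) (hgi : Integrable g) {z : E} (hz : z ≠ 0) {ε : ℝ}
    (hε : 0 < ε) :
    ∫⁻ x, ‖dirConjPoisson ε g z x‖ₑ ^ p ≤ C * ∫⁻ x, ‖g x‖ₑ ^ p := by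
  obtain ⟨c, ν, hc, hν, hline⟩ := exists_lintegral_eq_lintegral_lines hz
  have hvτ : Measurable (Function.uncurry fun (v : (ℝ ∙ z)ᗮ) (τ : ℝ) =>
      ‖g (v + τ • z)‖ₑ) := by
    refine Continuous.measurable (Continuous.enorm ?_)
    fun_prop
  have hvp : Measurable (Function.uncurry fun (v : (ℝ ∙ z)ᗮ) (τ : ℝ) =>
      ‖g (v + τ • z)‖ₑ ^ p) := hvτ.pow_const p
  have hfin : ∀ᵐ v : (ℝ ∙ z)ᗮ ∂ν, Integrable fun τ : ℝ => g (v + τ • z) := by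
    have h1 : c * ∫⁻ v, (∫⁻ τ : ℝ, ‖g (v + τ • z)‖ₑ) ∂ν ≠ ∞ := by
      rw [← hline _ hg.enorm.measurable]
      exact hgi.2.ne
    have h2 : ∫⁻ v, (∫⁻ τ : ℝ, ‖g (v + τ • z)‖ₑ) ∂ν ≠ ∞ := fun h => h1 (by
      rw [h, ENNReal.mul_top hc])
    filter_upwards [ae_lt_top hvτ.lintegral_prod_right' h2] with v hv
    exact ⟨Continuous.aestronglyMeasurable (by fun_prop), hv⟩
  rw [hline _ ((measurable_dirConjPoisson hg hε z).enorm.pow_const p),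
    hline _ (hg.enorm.measurable.pow_const p), mul_left_comm,
    ← lintegral_const_mul C (f := fun v : (ℝ ∙ z)ᗮ => ∫⁻ τ : ℝ, ‖g (v + τ • z)‖ₑ ^ p)
      hvp.lintegral_prod_right']
  refine mul_le_mul_right (lintegral_mono_ae ?_) c
  filter_upwards [hfin] with v hv
  simp_rw [dirConjPoisson_line hv hε]
  exact hC _ (Continuous.measurable (by fun_prop)) hv ε hε

/-- The directional Hilbert transform inherits, by Fatou's lemma, the `L ^ p` bound of the
conjugate Poisson integrals. Where its defining integral diverges it has the value zero, which is
harmless for the bound. -/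
theorem lintegral_dirHilbert_rpow_le {p : ℝ} (hp : 0 < p) {C : ℝ≥0∞}
    (hC : ∀ f : ℝ → ℂ, Measurable f → Integrable f → ∀ ε : ℝ, 0 < ε →
      ∫⁻ x, ‖conjPoisson ε f x‖ₑ ^ p ≤ C * ∫⁻ t, ‖f t‖ₑ ^ p)
    {g : E → ℂ} (hg : Continuous g) (hgi : Integrable g) (z : E) :
    ∫⁻ x, ‖dirHilbert g z x‖ₑ ^ p ≤ C * ∫⁻ x, ‖g x‖ₑ ^ p := by
  rcases eq_or_ne z 0 with rfl | hz
  · simp [dirHilbert, ENNReal.zero_rpow_of_pos hp]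
  set e : ℕ → ℝ := fun n => 1 / ((n : ℝ) + 1) with he
  have he0 : ∀ n, 0 < e n := fun n => by positivity
  have hlim0 : Tendsto e atTop (𝓝 0) := tendsto_one_div_add_atTop_nhds_zero_nat
  have hpt : ∀ x, ‖dirHilbert g z x‖ₑ ^ p ≤
      liminf (fun n => ‖dirConjPoisson (e n) g z x‖ₑ ^ p) atTop := by
    intro x
    by_cases hi : IntegrableOn (fun s : ℝ => s⁻¹ • (g (x - s • z) - g (x + s • z))) (Set.Ioi 0)
    · refine le_of_eq (Tendsto.liminf_eq ?_).symm
      refine (ENNReal.continuous_rpow_const.tendsto _).comp (Tendsto.enorm ?_)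
      refine tendsto_integral_of_dominated_convergence _
        (fun n => Continuous.aestronglyMeasurable ?_) hi.norm (fun n => ?_) ?_
      · have := continuous_conjKernel (he0 n)
        fun_prop
      · filter_upwards [self_mem_ae_restrict measurableSet_Ioi] with s hs
        have hs' : (0 : ℝ) < s := hs
        rw [norm_smul, norm_smul]
        refine mul_le_mul_of_nonneg_right ?_ (norm_nonneg _)
        rw [conjKernel, Real.norm_of_nonneg (by positivity), Real.norm_of_nonneg (by positivity),
          inv_eq_one_div, div_le_div_iff₀ (by positivity) hs']
        nlinarith [sq_nonneg (e n)]
      · filter_upwards [self_mem_ae_restrict measurableSet_Ioi] with s hs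
        have hs' : (0 : ℝ) < s := hs
        refine Tendsto.smul_const ?_ _
        have h1 : Tendsto (fun n => s / (s ^ 2 + e n ^ 2)) atTop (𝓝 (s / (s ^ 2 + 0 ^ 2))) :=
          tendsto_const_nhds.div (tendsto_const_nhds.add (hlim0.pow 2)) (by positivity)
        convert! h1 using 2
        field_simp
        simp
    · rw [dirHilbert, integral_undef hi, enorm_zero, ENNReal.zero_rpow_of_pos hp]
      exact bot_le
  calc ∫⁻ x, ‖dirHilbert g z x‖ₑ ^ p
      ≤ ∫⁻ x, liminf (fun n => ‖dirConjPoisson (e n) g z x‖ₑ ^ p) atTop := lintegral_mono hpt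
    _ ≤ liminf (fun n => ∫⁻ x, ‖dirConjPoisson (e n) g z x‖ₑ ^ p) atTop :=
        lintegral_liminf_le fun n =>
          (measurable_dirConjPoisson hg (he0 n) z).enorm.pow_const p
    _ ≤ C * ∫⁻ x, ‖g x‖ₑ ^ p := by
        refine liminf_le_of_le (by isBoundedDefault) fun b hb => ?_
        obtain ⟨n, hn⟩ := hb.exists
        exact hn.trans (lintegral_dirConjPoisson_rpow_le hC hg hgi hz (he0 n))

end

/-! ### The Riesz kernel -/

/-- The kernel `u j / |u| ^ (n + 1)` of the `j`-th Riesz transform, without the normalizing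
constant. -/
noncomputable def rieszKernel {n : ℕ} (j : Fin n) (u : EuclideanSpace ℝ (Fin n)) : ℝ :=
  u j / ‖u‖ ^ (n + 1)

/-- The Riesz transform of `g` without the normalizing constant. The odd kernel is folded onto the
differences `g (x - u) - g (x + u)`, so that for regular `g` the integral converges absolutely and
no principal value is needed. -/
noncomputable def foldedRiesz {n : ℕ} (j : Fin n) (g : EuclideanSpace ℝ (Fin n) → ℂ)
    (x : EuclideanSpace ℝ (Fin n)) : ℂ :=
  (2 : ℝ)⁻¹ • ∫ u, rieszKernel j u • (g (x - u) - g (x + u))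

section

variable {n : ℕ} {j : Fin n} {g : EuclideanSpace ℝ (Fin n) → ℂ} {x : EuclideanSpace ℝ (Fin n)}

theorem rieszKernel_neg (u : EuclideanSpace ℝ (Fin n)) :
    rieszKernel j (-u) = -rieszKernel j u := by
  simp [rieszKernel, neg_div]

theorem abs_apply_le_norm (u : EuclideanSpace ℝ (Fin n)) : |u j| ≤ ‖u‖ := by
  simpa using PiLp.norm_apply_le u j

@[fun_prop]
theorem measurable_rieszKernel : Measurable (rieszKernel j) := by
  unfold rieszKernel
  fun_prop

theorem norm_rieszKernel_le {ε : ℝ} (hε : 0 < ε) {u : EuclideanSpace ℝ (Fin n)}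
    (hu : ε ≤ ‖u‖) : ‖rieszKernel j u‖ ≤ (ε ^ n)⁻¹ := by
  have hu0 : 0 < ‖u‖ := hε.trans_le hu
  rw [rieszKernel, norm_div, Real.norm_eq_abs, norm_pow, norm_norm]
  calc |u j| / ‖u‖ ^ (n + 1) ≤ ‖u‖ / ‖u‖ ^ (n + 1) := by gcongr; exact abs_apply_le_norm u
    _ = (‖u‖ ^ n)⁻¹ := by rw [pow_succ']; field_simp
    _ ≤ (ε ^ n)⁻¹ := by gcongr

theorem integrableOn_rieszKernel_smul (hgi : Integrable g) {ε : ℝ} (hε : 0 < ε) :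
    IntegrableOn (fun u => rieszKernel j u • g u) {u | ε ≤ ‖u‖} := by
  have hS : MeasurableSet {u : EuclideanSpace ℝ (Fin n) | ε ≤ ‖u‖} :=
    measurableSet_le measurable_const measurable_norm
  refine Integrable.bdd_smul hgi.integrableOn (ε ^ n)⁻¹
    measurable_rieszKernel.aestronglyMeasurable ?_
  filter_upwards [self_mem_ae_restrict hS] with u hu
  exact norm_rieszKernel_le hε hu

/-- The folded integral converges absolutely: near the origin the difference of the values of `g`
is `O(|u|)`, which leaves the integrable singularity `|u| ^ (1 - n)`. -/
theorem integrable_rieszKernel_smul_sub (hg : Continuous g) (hgi : Integrable g) {L : ℝ}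
    (hL : ∀ u, ‖u‖ ≤ 1 → ‖g (x - u) - g (x + u)‖ ≤ L * ‖u‖) :
    Integrable fun u => rieszKernel j u • (g (x - u) - g (x + u)) := by
  have hn : 1 ≤ n := j.pos
  have hm : Measurable fun u => rieszKernel j u • (g (x - u) - g (x + u)) :=
    measurable_rieszKernel.smul (Continuous.measurable (by fun_prop))
  have hball : IntegrableOn (fun u => rieszKernel j u • (g (x - u) - g (x + u)))
      (Metric.closedBall 0 1) := by
    have hloc : LocallyIntegrable ((Metric.closedBall 0 1).indicator
        fun u => rieszKernel j u • (g (x - u) - g (x + u))) := by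
      refine locallyIntegrable_of_norm_le_rpow (C := L) (α := (n : ℝ) - 1) (by simpa using hn)
        (by simp) (Eventually.of_forall fun u => ?_)
        (hm.indicator Metric.isClosed_closedBall.measurableSet).aestronglyMeasurable
      have hL0 : 0 ≤ L := by
        let e : EuclideanSpace ℝ (Fin n) := EuclideanSpace.single j 1
        have he : ‖e‖ = 1 := by simp [e]
        have := (norm_nonneg _).trans (hL e he.le)
        rwa [he, mul_one] at this
      by_cases hu : u ∈ Metric.closedBall (0 : EuclideanSpace ℝ (Fin n)) 1
      · rw [Set.indicator_of_mem hu]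
        rcases eq_or_ne u 0 with rfl | hu0
        · simp only [rieszKernel, PiLp.zero_apply, zero_div, zero_smul, norm_zero]
          exact mul_nonneg hL0 (Real.rpow_nonneg le_rfl _)
        have hu1 : 0 < ‖u‖ := norm_pos_iff.2 hu0
        rw [norm_smul]
        calc ‖rieszKernel j u‖ * ‖g (x - u) - g (x + u)‖
            ≤ (‖u‖ ^ n)⁻¹ * (L * ‖u‖) :=
              mul_le_mul (norm_rieszKernel_le hu1 le_rfl) (hL u (by simpa using hu))
                (norm_nonneg _) (by positivity)
          _ = L * ‖u‖ ^ (-((n : ℝ) - 1)) := by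
              rw [neg_sub, Real.rpow_sub hu1, Real.rpow_one, Real.rpow_natCast]
              field_simp
      · rw [Set.indicator_of_notMem hu, norm_zero]
        exact mul_nonneg hL0 (Real.rpow_nonneg (norm_nonneg _) _)
    have h2 := hloc.integrableOn_isCompact (isCompact_closedBall 0 1)
    exact (integrableOn_congr_fun (fun u hu => Set.indicator_of_mem hu _)
      Metric.isClosed_closedBall.measurableSet).1 h2
  have hout : IntegrableOn (fun u => rieszKernel j u • (g (x - u) - g (x + u)))
      {u | 1 ≤ ‖u‖} :=
    integrableOn_rieszKernel_smul ((hgi.comp_sub_left x).sub (hgi.comp_add_left x)) one_pos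
  rw [← integrableOn_univ]
  refine (hball.union hout).mono_set fun u _ => ?_
  rcases le_total ‖u‖ 1 with h | h
  · exact Or.inl (by simpa using h)
  · exact Or.inr h

theorem setIntegral_rieszKernel_smul_sub (hgi : Integrable g) {ε : ℝ} (hε : 0 < ε) :
    ∫ u in {u | ε ≤ ‖u‖}, rieszKernel j u • g (x - u) =
      (2 : ℝ)⁻¹ • ∫ u in {u | ε ≤ ‖u‖}, rieszKernel j u • (g (x - u) - g (x + u)) := by
  have hS : MeasurableSet {u : EuclideanSpace ℝ (Fin n) | ε ≤ ‖u‖} :=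
    measurableSet_le measurable_const measurable_norm
  have h1 : IntegrableOn (fun u => rieszKernel j u • g (x - u)) {u | ε ≤ ‖u‖} :=
    integrableOn_rieszKernel_smul (hgi.comp_sub_left x) hε
  have h2 : IntegrableOn (fun u => rieszKernel j u • g (x + u)) {u | ε ≤ ‖u‖} :=
    integrableOn_rieszKernel_smul (hgi.comp_add_left x) hε
  have h3 : ∫ u in {u | ε ≤ ‖u‖}, rieszKernel j u • g (x + u) =
      -∫ u in {u | ε ≤ ‖u‖}, rieszKernel j u • g (x - u) := by
    rw [← integral_indicator hS, ← integral_indicator hS, ← integral_neg_eq_self, ← integral_neg]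
    refine integral_congr_ae (Eventually.of_forall fun u => ?_)
    by_cases hu : ε ≤ ‖u‖
    · have hu' : -u ∈ {u : EuclideanSpace ℝ (Fin n) | ε ≤ ‖u‖} := by simpa using hu
      have hu'' : u ∈ {u : EuclideanSpace ℝ (Fin n) | ε ≤ ‖u‖} := hu
      simp only [Set.indicator_of_mem hu', Set.indicator_of_mem hu'', rieszKernel_neg, neg_smul,
        sub_eq_add_neg]
    · have hu' : -u ∉ {u : EuclideanSpace ℝ (Fin n) | ε ≤ ‖u‖} := by simpa using hu
      have hu'' : u ∉ {u : EuclideanSpace ℝ (Fin n) | ε ≤ ‖u‖} := hu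
      simp only [Set.indicator_of_notMem hu', Set.indicator_of_notMem hu'', neg_zero]
  simp_rw [smul_sub]
  rw [integral_sub h1 h2, h3]
  module

/-- The principal value exists and is the folded integral. -/
theorem tendsto_setIntegral_rieszKernel (hg : Continuous g) (hgi : Integrable g) {L : ℝ}
    (hL : ∀ u, ‖u‖ ≤ 1 → ‖g (x - u) - g (x + u)‖ ≤ L * ‖u‖) :
    Tendsto (fun ε : ℝ => ∫ u in {u | ε ≤ ‖u‖}, rieszKernel j u • g (x - u)) (𝓝[>] 0)
      (𝓝 (foldedRiesz j g x)) := by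
  have hi := integrable_rieszKernel_smul_sub (j := j) hg hgi hL
  have hS : ∀ ε : ℝ, MeasurableSet {u : EuclideanSpace ℝ (Fin n) | ε ≤ ‖u‖} := fun ε =>
    measurableSet_le measurable_const measurable_norm
  have hlim : Tendsto (fun ε : ℝ => ∫ u in {u | ε ≤ ‖u‖},
      rieszKernel j u • (g (x - u) - g (x + u))) (𝓝[>] 0)
      (𝓝 (∫ u, rieszKernel j u • (g (x - u) - g (x + u)))) := by
    simp_rw [← integral_indicator (hS _)]
    refine tendsto_integral_filter_of_dominated_convergence _
      (Eventually.of_forall fun ε => (hi.indicator (hS ε)).aestronglyMeasurable)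
      (Eventually.of_forall fun ε => Eventually.of_forall fun u =>
        norm_indicator_le_norm_self _ _) hi.norm (Eventually.of_forall fun u => ?_)
    refine tendsto_const_nhds.congr' ?_
    rcases eq_or_ne u 0 with rfl | hu
    · simp [Set.indicator_apply]
    · filter_upwards [Ioo_mem_nhdsGT (norm_pos_iff.2 hu)] with ε hε
      have : u ∈ {u : EuclideanSpace ℝ (Fin n) | ε ≤ ‖u‖} := hε.2.le
      rw [Set.indicator_of_mem this]
  refine (hlim.const_smul (2 : ℝ)⁻¹).congr' ?_
  filter_upwards [self_mem_nhdsWithin] with ε hε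
  exact (setIntegral_rieszKernel_smul_sub hgi hε).symm

end

/-! ### The Riesz transform as an average of directional Hilbert transforms -/

/-- The identity `∫_{s ≥ r} s ^ (-n - 2) ds = r ^ (-n - 1) / (n + 1)`, written over the half-line
`s > 0` for the exchange of integrals. -/
theorem integrableOn_indicator_Ici_inv_pow (n : ℕ) {r : ℝ} (hr : 0 < r) :
    IntegrableOn ((Set.Ici r).indicator fun s : ℝ => (s ^ (n + 2))⁻¹) (Set.Ioi 0) ∧
      ∫ s in Set.Ioi (0 : ℝ), (Set.Ici r).indicator (fun s : ℝ => (s ^ (n + 2))⁻¹) s =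
        ((n + 1 : ℝ) * r ^ (n + 1))⁻¹ := by
  have e : Set.EqOn (fun s : ℝ => s ^ (-((n : ℝ) + 2))) (fun s : ℝ => (s ^ (n + 2))⁻¹)
      (Set.Ioi r) := fun s hs => by
    have hs0 : 0 < s := hr.trans hs
    simp only
    rw [Real.rpow_neg hs0.le]
    norm_cast
  have ha : -((n : ℝ) + 2) < -1 := by
    have : (0 : ℝ) ≤ n := n.cast_nonneg
    linarith
  have hsub : Set.Ici r ∩ Set.Ioi 0 = Set.Ici r :=
    Set.inter_eq_left.2 fun s hs => hr.trans_le hs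
  constructor
  · rw [integrableOn_indicator_iff measurableSet_Ici, hsub, integrableOn_Ici_iff_integrableOn_Ioi]
    exact (integrableOn_Ioi_rpow_of_lt ha hr).congr_fun e measurableSet_Ioi
  · rw [setIntegral_indicator measurableSet_Ici, Set.inter_comm, hsub, integral_Ici_eq_integral_Ioi,
      ← setIntegral_congr_fun measurableSet_Ioi e, integral_Ioi_rpow_of_lt ha hr,
      show -((n : ℝ) + 2) + 1 = -((n : ℝ) + 1) by ring, Real.rpow_neg hr.le]
    norm_cast
    have : (n + 1 : ℝ) ≠ 0 := by positivity
    push_cast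
    field_simp

/-- The method of rotations, in the form of an average over the unit ball. The factor
`1[|u| ≤ s] s ^ (-n - 2)` integrates in `s` to the Riesz kernel; integrating in `u` first and
substituting `u = s z` produces `dirHilbert`. -/
theorem foldedRiesz_eq_integral_dirHilbert {n : ℕ} {j : Fin n} {g : EuclideanSpace ℝ (Fin n) → ℂ}
    {x : EuclideanSpace ℝ (Fin n)} (hg : Continuous g)
    (hi : Integrable fun u => rieszKernel j u • (g (x - u) - g (x + u))) :
    foldedRiesz j g x = (((n : ℝ) + 1) / 2) •
      ∫ z in Metric.closedBall 0 1, z j • dirHilbert g z x := by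
  have hn1 : (n + 1 : ℝ) ≠ 0 := by positivity
  set D : EuclideanSpace ℝ (Fin n) → ℂ := fun u => g (x - u) - g (x + u) with hD
  have hDc : Continuous D := by fun_prop
  set Ψ : ℝ → EuclideanSpace ℝ (Fin n) → ℂ := fun s u =>
    (Set.Ici ‖u‖).indicator (fun s : ℝ => (s ^ (n + 2))⁻¹) s • (u j • D u) with hΨ
  have hΨm : Measurable (Function.uncurry Ψ) := by
    have hset : MeasurableSet {w : ℝ × EuclideanSpace ℝ (Fin n) | ‖w.2‖ ≤ w.1} :=
      measurableSet_le (by fun_prop) (by fun_prop)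
    have h1 : Measurable ({w : ℝ × EuclideanSpace ℝ (Fin n) | ‖w.2‖ ≤ w.1}.indicator
        fun w => (w.1 ^ (n + 2))⁻¹) := Measurable.indicator (by fun_prop) hset
    have h2 : Measurable fun w : ℝ × EuclideanSpace ℝ (Fin n) => w.2 j • D w.2 :=
      Continuous.measurable (by fun_prop)
    exact h1.smul h2
  -- the integral over `s` reproduces the Riesz kernel
  have hmass : ∀ u, ∫ s in Set.Ioi (0 : ℝ), Ψ s u =
      ((n : ℝ) + 1)⁻¹ • (rieszKernel j u • D u) := by
    intro u
    rcases eq_or_ne u 0 with rfl | hu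
    · simp [hΨ, rieszKernel]
    rw [hΨ]
    simp only
    rw [integral_smul_const, (integrableOn_indicator_Ici_inv_pow n (norm_pos_iff.2 hu)).2,
      smul_smul, smul_smul, rieszKernel]
    congr 1
    rw [mul_inv]
    ring
  have hmassn : ∀ u, ∫ s in Set.Ioi (0 : ℝ), ‖Ψ s u‖ =
      ((n : ℝ) + 1)⁻¹ * ‖rieszKernel j u • D u‖ := by
    intro u
    rcases eq_or_ne u 0 with rfl | hu
    · simp [hΨ, rieszKernel]
    have : ∀ s ∈ Set.Ioi (0 : ℝ), ‖Ψ s u‖ =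
        (Set.Ici ‖u‖).indicator (fun s : ℝ => (s ^ (n + 2))⁻¹) s * ‖u j • D u‖ := by
      intro s hs
      have hs0 : (0 : ℝ) < s := hs
      rw [hΨ]
      simp only
      rw [norm_smul, Real.norm_of_nonneg (Set.indicator_apply_nonneg fun _ => by positivity)]
    rw [setIntegral_congr_fun measurableSet_Ioi this, integral_mul_const,
      (integrableOn_indicator_Ici_inv_pow n (norm_pos_iff.2 hu)).2, norm_smul, norm_smul,
      rieszKernel, norm_div, norm_pow, norm_norm, mul_inv]
    ring
  have hΨi : Integrable (Function.uncurry Ψ) ((volume.restrict (Set.Ioi 0)).prod volume) := by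
    rw [integrable_prod_iff' hΨm.aestronglyMeasurable]
    refine ⟨Eventually.of_forall fun u => ?_, ?_⟩
    · rcases eq_or_ne u 0 with rfl | hu
      · simp [hΨ]
      · exact Integrable.smul_const (integrableOn_indicator_Ici_inv_pow n (norm_pos_iff.2 hu)).1
          (u j • D u)
    · simp only [Function.uncurry_apply_pair, hmassn]
      exact hi.norm.const_mul _
  -- the same function after the substitution `u = s z` on the slices
  set Φ : ℝ → EuclideanSpace ℝ (Fin n) → ℂ := fun s z =>
    (Metric.closedBall 0 1).indicator (fun z => z j • (s⁻¹ • D (s • z))) z with hΦ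
  have hΦΨ : ∀ s : ℝ, 0 < s → ∀ z, Φ s z = s ^ n • Ψ s (s • z) := by
    intro s hs z
    have hmem : s ∈ Set.Ici ‖s • z‖ ↔ z ∈ Metric.closedBall (0 : EuclideanSpace ℝ (Fin n)) 1 := by
      rw [Set.mem_Ici, norm_smul, Real.norm_of_nonneg hs.le, mem_closedBall_zero_iff]
      exact mul_le_iff_le_one_right hs
    rw [hΦ, hΨ]
    simp only
    by_cases hz : z ∈ Metric.closedBall (0 : EuclideanSpace ℝ (Fin n)) 1
    · rw [Set.indicator_of_mem hz, Set.indicator_of_mem (hmem.2 hz), smul_smul, smul_smul,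
        smul_smul, PiLp.smul_apply, smul_eq_mul]
      congr 1
      field_simp
      ring
    · rw [Set.indicator_of_notMem hz, Set.indicator_of_notMem (mt hmem.1 hz), zero_smul, smul_zero]
  have hscale : ∀ s : ℝ, 0 < s → ∀ F : EuclideanSpace ℝ (Fin n) → ℝ,
      ∫ z, s ^ n * F (s • z) = ∫ u, F u := by
    intro s hs F
    rw [integral_const_mul, Measure.integral_comp_smul, finrank_euclideanSpace_fin,
      abs_of_pos (by positivity), smul_eq_mul, ← mul_assoc, mul_inv_cancel₀ (by positivity),
      one_mul]
  have hscale' : ∀ s : ℝ, 0 < s → ∫ z, Φ s z = ∫ u, Ψ s u := by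
    intro s hs
    simp_rw [hΦΨ s hs]
    rw [integral_smul, Measure.integral_comp_smul, finrank_euclideanSpace_fin,
      abs_of_pos (by positivity), smul_smul, mul_inv_cancel₀ (by positivity), one_smul]
  have hΦm : Measurable (Function.uncurry Φ) := by
    have hset : MeasurableSet {w : ℝ × EuclideanSpace ℝ (Fin n) |
        w.2 ∈ Metric.closedBall (0 : EuclideanSpace ℝ (Fin n)) 1} :=
      measurable_snd Metric.isClosed_closedBall.measurableSet
    have h2 : Measurable fun w : ℝ × EuclideanSpace ℝ (Fin n) => D (w.1 • w.2) :=
      Continuous.measurable (by fun_prop)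
    exact Measurable.indicator (f := fun w : ℝ × EuclideanSpace ℝ (Fin n) =>
      w.2 j • (w.1⁻¹ • D (w.1 • w.2)))
      (Measurable.smul (f := fun w : ℝ × EuclideanSpace ℝ (Fin n) => w.2 j) (by fun_prop)
        (Measurable.smul (f := fun w : ℝ × EuclideanSpace ℝ (Fin n) => w.1⁻¹) (by fun_prop) h2))
      hset
  have hΦi : Integrable (Function.uncurry Φ) ((volume.restrict (Set.Ioi 0)).prod volume) := by
    obtain ⟨h1, h2⟩ := (integrable_prod_iff hΨm.aestronglyMeasurable).1 hΨi
    rw [integrable_prod_iff hΦm.aestronglyMeasurable]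
    constructor
    · filter_upwards [h1, self_mem_ae_restrict measurableSet_Ioi] with s hs1 hs
      have hs0 : (0 : ℝ) < s := hs
      simp only [Function.uncurry_apply_pair, hΦΨ s hs0] at hs1 ⊢
      exact (hs1.comp_smul hs0.ne').smul (s ^ n)
    · refine h2.congr ?_
      filter_upwards [self_mem_ae_restrict measurableSet_Ioi] with s hs
      have hs0 : (0 : ℝ) < s := hs
      simp only [Function.uncurry_apply_pair, hΦΨ s hs0, norm_smul]
      rw [Real.norm_of_nonneg (by positivity), hscale s hs0 fun u => ‖Ψ s u‖]
  have key : ∫ u, ((n : ℝ) + 1)⁻¹ • (rieszKernel j u • D u) =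
      ∫ z in Metric.closedBall 0 1, z j • dirHilbert g z x := by
    simp_rw [← hmass]
    rw [← integral_integral_swap hΨi,
      ← setIntegral_congr_fun measurableSet_Ioi fun s hs => hscale' s hs,
      integral_integral_swap hΦi,
      ← integral_indicator Metric.isClosed_closedBall.measurableSet]
    refine integral_congr_ae (Eventually.of_forall fun z => ?_)
    simp only [hΦ]
    by_cases hz : z ∈ Metric.closedBall (0 : EuclideanSpace ℝ (Fin n)) 1
    · simp only [Set.indicator_of_mem hz]
      rw [integral_smul, dirHilbert]
    · simp only [Set.indicator_of_notMem hz, integral_zero]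
  rw [← key, integral_smul, smul_smul, foldedRiesz]
  congr 1
  field_simp

theorem measurable_dirHilbert {n : ℕ} {g : EuclideanSpace ℝ (Fin n) → ℂ} (hg : Continuous g) :
    Measurable (Function.uncurry fun x z : EuclideanSpace ℝ (Fin n) => dirHilbert g z x) := by
  have hm : Measurable (Function.uncurry
      fun (w : EuclideanSpace ℝ (Fin n) × EuclideanSpace ℝ (Fin n)) (s : ℝ) =>
        s⁻¹ • (g (w.1 - s • w.2) - g (w.1 + s • w.2))) := by
    refine Measurable.smul (f := fun w : (EuclideanSpace ℝ (Fin n) × EuclideanSpace ℝ (Fin n)) × ℝ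
      => w.2⁻¹) (by fun_prop) (Continuous.measurable ?_)
    fun_prop
  exact (StronglyMeasurable.integral_prod_right (ν := volume.restrict (Set.Ioi 0))
    hm.stronglyMeasurable).measurable

theorem measurable_foldedRiesz {n : ℕ} {j : Fin n} {g : EuclideanSpace ℝ (Fin n) → ℂ}
    (hg : Continuous g) : Measurable (foldedRiesz j g) := by
  have hm : Measurable (Function.uncurry fun x u : EuclideanSpace ℝ (Fin n) =>
      rieszKernel j u • (g (x - u) - g (x + u))) := by
    refine Measurable.smul (f := fun w : EuclideanSpace ℝ (Fin n) × EuclideanSpace ℝ (Fin n) =>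
      rieszKernel j w.2) (by fun_prop) (Continuous.measurable ?_)
    fun_prop
  exact (StronglyMeasurable.integral_prod_right (ν := volume)
    hm.stronglyMeasurable).measurable.const_smul (2 : ℝ)⁻¹

/-- The `L ^ p` bound for the Riesz transform: Jensen's inequality on the unit ball reduces it to the
bound for directional Hilbert transforms, which is uniform in the direction. -/
theorem exists_lintegral_foldedRiesz_rpow_le {n : ℕ} (j : Fin n) {p : ℝ} (hp : 1 < p) :
    ∃ C : ℝ≥0∞, C ≠ ∞ ∧ ∀ g : EuclideanSpace ℝ (Fin n) → ℂ, Continuous g → Integrable g →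
      (∀ x, ∃ L, ∀ u, ‖u‖ ≤ 1 → ‖g (x - u) - g (x + u)‖ ≤ L * ‖u‖) →
      ∫⁻ x, ‖foldedRiesz j g x‖ₑ ^ p ≤ C * ∫⁻ x, ‖g x‖ₑ ^ p := by
  obtain ⟨C, hC, hCb⟩ := exists_lintegral_conjPoisson_rpow_le hp
  have hp0 : 0 < p := by linarith
  set B : Set (EuclideanSpace ℝ (Fin n)) := Metric.closedBall 0 1 with hB
  have hBm : MeasurableSet B := Metric.isClosed_closedBall.measurableSet
  have hBfin : volume B ≠ ∞ := measure_closedBall_lt_top.ne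
  set c : ℝ≥0∞ := ‖((n : ℝ) + 1) / 2‖ₑ with hc
  have hctop : c ≠ ∞ := enorm_ne_top
  have hcp : c ^ p ≠ ∞ := ENNReal.rpow_ne_top_of_nonneg hp0.le hctop
  have hBp : volume B ^ (p - 1) ≠ ∞ := ENNReal.rpow_ne_top_of_nonneg (by linarith) hBfin
  refine ⟨c ^ p * volume B ^ (p - 1) * (volume B * C), by finiteness,
    fun g hg hgi hL => ?_⟩
  have hHm := measurable_dirHilbert hg
  have hpt : ∀ x, ‖foldedRiesz j g x‖ₑ ^ p ≤
      c ^ p * volume B ^ (p - 1) * ∫⁻ z in B, ‖dirHilbert g z x‖ₑ ^ p := by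
    intro x
    obtain ⟨L, hLx⟩ := hL x
    have hHx : Measurable fun z => dirHilbert g z x := hHm.comp measurable_prodMk_left
    rw [foldedRiesz_eq_integral_dirHilbert hg (integrable_rieszKernel_smul_sub hg hgi hLx),
      enorm_smul, ENNReal.mul_rpow_of_nonneg _ _ hp0.le, mul_assoc]
    gcongr
    have h1 : ‖∫ z in B, z j • dirHilbert g z x‖ₑ ≤ ∫⁻ z in B, ‖dirHilbert g z x‖ₑ := by
      refine (enorm_integral_le_lintegral_enorm _).trans (setLIntegral_mono' hBm fun z hz => ?_)
      rw [enorm_smul]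
      have : ‖z j‖ₑ ≤ 1 := by
        rw [← enorm_one (G := ℝ), enorm_le_iff_norm_le, norm_one]
        exact (abs_apply_le_norm z).trans (by simpa [hB] using hz)
      exact (mul_le_mul_left this _).trans (one_mul _).le
    refine (ENNReal.rpow_le_rpow h1 hp0.le).trans ?_
    have h2 := lintegral_rpow_le_measure_univ_mul (volume.restrict B) hHx.enorm.aemeasurable hp
    rwa [Measure.restrict_apply_univ] at h2
  have hHp : Measurable (Function.uncurry fun x z : EuclideanSpace ℝ (Fin n) =>
      ‖dirHilbert g z x‖ₑ ^ p) := hHm.enorm.pow_const p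
  calc ∫⁻ x, ‖foldedRiesz j g x‖ₑ ^ p
      ≤ ∫⁻ x, c ^ p * volume B ^ (p - 1) * ∫⁻ z in B, ‖dirHilbert g z x‖ₑ ^ p :=
        lintegral_mono hpt
    _ = c ^ p * volume B ^ (p - 1) * ∫⁻ z in B, ∫⁻ x, ‖dirHilbert g z x‖ₑ ^ p := by
        rw [lintegral_const_mul (c ^ p * volume B ^ (p - 1))
          (f := fun x => ∫⁻ z in B, ‖dirHilbert g z x‖ₑ ^ p) hHp.lintegral_prod_right',
          lintegral_lintegral_swap hHp.aemeasurable]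
    _ ≤ c ^ p * volume B ^ (p - 1) * ∫⁻ _ in B, C * ∫⁻ x, ‖g x‖ₑ ^ p := by
        gcongr with z
        exact lintegral_dirHilbert_rpow_le hp0 hCb hg hgi z
    _ = c ^ p * volume B ^ (p - 1) * (volume B * C) * ∫⁻ x, ‖g x‖ₑ ^ p := by
        rw [setLIntegral_const]
        ring

/-! ### The linear canonical Riesz transform of a Schwartz function -/

section

variable {n : ℕ}

theorem contDiff_chirp (a b : Fin n → ℝ) : ContDiff ℝ 1 (chirp a b) := by
  have h : ContDiff ℝ 1 fun x : EuclideanSpace ℝ (Fin n) => ∑ k, b k / (2 * a k) * x k ^ 2 := by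
    fun_prop
  exact (contDiff_const.mul (Complex.ofRealCLM.contDiff.comp h)).cexp

theorem norm_chirp (a b : Fin n → ℝ) (x : EuclideanSpace ℝ (Fin n)) : ‖chirp a b x‖ = 1 := by
  rw [chirp, mul_comm, Complex.norm_exp_ofReal_mul_I]

theorem exists_norm_sub_le_of_contDiff {g : EuclideanSpace ℝ (Fin n) → ℂ} (hg : ContDiff ℝ 1 g)
    (x : EuclideanSpace ℝ (Fin n)) :
    ∃ L, ∀ u, ‖u‖ ≤ 1 → ‖g (x - u) - g (x + u)‖ ≤ L * ‖u‖ := by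
  obtain ⟨M, hM⟩ := (isCompact_closedBall x 1).exists_bound_of_continuousOn
    (hg.continuous_fderiv one_ne_zero).continuousOn
  refine ⟨M * 2, fun u hu => ?_⟩
  have h := (convex_closedBall x 1).norm_image_sub_le_of_norm_fderiv_le
    (fun y _ => hg.differentiable one_ne_zero y) hM
    (x := x + u) (y := x - u) (by simpa using hu) (by simpa using hu)
  refine h.trans (le_of_eq ?_)
  rw [show x - u - (x + u) = (-2 : ℝ) • u by module, norm_smul]
  norm_num
  ring

variable (A : Fin n → Matrix.SpecialLinearGroup (Fin 2) ℝ) (j : Fin n)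

/-- The product of a Schwartz function with the chirp of the linear canonical transform. -/
noncomputable def chirped (f : 𝓢(EuclideanSpace ℝ (Fin n), ℂ)) (y : EuclideanSpace ℝ (Fin n)) :
    ℂ :=
  f y * chirp (fun k => A k 0 1) (fun k => A k 0 0) y

theorem contDiff_chirped (f : 𝓢(EuclideanSpace ℝ (Fin n), ℂ)) : ContDiff ℝ 1 (chirped A f) :=
  (f.smooth 1).mul (contDiff_chirp _ _)

theorem norm_chirped (f : 𝓢(EuclideanSpace ℝ (Fin n), ℂ)) (y : EuclideanSpace ℝ (Fin n)) :
    ‖chirped A f y‖ = ‖f y‖ := by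
  rw [chirped, norm_mul, norm_chirp, mul_one]

theorem integrable_chirped (f : 𝓢(EuclideanSpace ℝ (Fin n), ℂ)) : Integrable (chirped A f) :=
  f.integrable.congr' (contDiff_chirped A f).continuous.aestronglyMeasurable
    (Eventually.of_forall fun y => (norm_chirped A f y).symm)

theorem lcrtIntegrand_eq (f : 𝓢(EuclideanSpace ℝ (Fin n), ℂ)) (x y : EuclideanSpace ℝ (Fin n)) :
    lcrtIntegrand A j f x y = rieszKernel j (x - y) • chirped A f y := by
  rw [lcrtIntegrand, rieszKernel, chirped, Complex.real_smul, PiLp.sub_apply, Complex.ofReal_div]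
  ring

theorem indicator_lcrtIntegrand (f : 𝓢(EuclideanSpace ℝ (Fin n), ℂ))
    (x : EuclideanSpace ℝ (Fin n)) (ε : ℝ) :
    {y | ε ≤ ‖x - y‖}.indicator (lcrtIntegrand A j f x) = fun y =>
      {u | ε ≤ ‖u‖}.indicator (fun u => rieszKernel j u • chirped A f (x - u)) (x - y) := by
  funext y
  simp only [Set.indicator_apply, Set.mem_ofPred_eq, lcrtIntegrand_eq, sub_sub_cancel]

theorem measurableSet_le_norm_sub (x : EuclideanSpace ℝ (Fin n)) (ε : ℝ) :
    MeasurableSet {y : EuclideanSpace ℝ (Fin n) | ε ≤ ‖x - y‖} :=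
  measurableSet_le measurable_const (by fun_prop)

theorem measurableSet_le_norm (ε : ℝ) :
    MeasurableSet {y : EuclideanSpace ℝ (Fin n) | ε ≤ ‖y‖} :=
  measurableSet_le measurable_const measurable_norm

theorem integrableOn_lcrtIntegrand (f : 𝓢(EuclideanSpace ℝ (Fin n), ℂ))
    (x : EuclideanSpace ℝ (Fin n)) {ε : ℝ} (hε : 0 < ε) :
    IntegrableOn (lcrtIntegrand A j f x) {y | ε ≤ ‖x - y‖} := by
  rw [← integrable_indicator_iff (measurableSet_le_norm_sub x ε), indicator_lcrtIntegrand]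
  have h : IntegrableOn (fun u => rieszKernel j u • chirped A f (x - u)) {u | ε ≤ ‖u‖} :=
    integrableOn_rieszKernel_smul ((integrable_chirped A f).comp_sub_left x) hε
  exact ((integrable_indicator_iff (measurableSet_le_norm ε)).2 h).comp_sub_left x

theorem lcrtTruncated_eq (f : 𝓢(EuclideanSpace ℝ (Fin n), ℂ)) (x : EuclideanSpace ℝ (Fin n))
    (ε : ℝ) :
    lcrtTruncated A j f x ε =
      ∫ u in {u | ε ≤ ‖u‖}, rieszKernel j u • chirped A f (x - u) := by
  rw [lcrtTruncated, ← integral_indicator (measurableSet_le_norm_sub x ε),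
    indicator_lcrtIntegrand, ← integral_indicator (measurableSet_le_norm ε)]
  exact integral_sub_left_eq_self _ volume x

theorem tendsto_lcrtTruncated (f : 𝓢(EuclideanSpace ℝ (Fin n), ℂ))
    (x : EuclideanSpace ℝ (Fin n)) :
    Tendsto (lcrtTruncated A j f x) (𝓝[>] 0) (𝓝 (foldedRiesz j (chirped A f) x)) := by
  obtain ⟨L, hL⟩ := exists_norm_sub_le_of_contDiff (contDiff_chirped A f) x
  simpa only [← lcrtTruncated_eq] using tendsto_setIntegral_rieszKernel (j := j)
    (contDiff_chirped A f).continuous (integrable_chirped A f) hL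

theorem lcrt_eq (f : 𝓢(EuclideanSpace ℝ (Fin n), ℂ)) (x : EuclideanSpace ℝ (Fin n)) :
    lcrt A j f x = (rieszConst n : ℂ) * chirp (fun k => A k 0 1) (fun k => -(A k 1 1)) x *
      foldedRiesz j (chirped A f) x := by
  rw [lcrt, (tendsto_lcrtTruncated A j f x).limUnder_eq]

theorem integrable_rieszKernel_smul_chirped (f : 𝓢(EuclideanSpace ℝ (Fin n), ℂ))
    (x : EuclideanSpace ℝ (Fin n)) :
    Integrable fun u => rieszKernel j u • (chirped A f (x - u) - chirped A f (x + u)) := by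
  obtain ⟨L, hL⟩ := exists_norm_sub_le_of_contDiff (contDiff_chirped A f) x
  exact integrable_rieszKernel_smul_sub (contDiff_chirped A f).continuous
    (integrable_chirped A f) hL

theorem lcrt_add (f g : 𝓢(EuclideanSpace ℝ (Fin n), ℂ)) :
    lcrt A j (f + g : 𝓢(EuclideanSpace ℝ (Fin n), ℂ)) = lcrt A j f + lcrt A j g := by
  funext x
  have h : foldedRiesz j (chirped A (f + g)) x =
      foldedRiesz j (chirped A f) x + foldedRiesz j (chirped A g) x := by
    rw [foldedRiesz, foldedRiesz, foldedRiesz, ← smul_add,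
      ← integral_add (integrable_rieszKernel_smul_chirped A j f x)
        (integrable_rieszKernel_smul_chirped A j g x)]
    congr 2
    funext u
    simp only [chirped, add_apply, Complex.real_smul]
    ring
  rw [Pi.add_apply, lcrt_eq, lcrt_eq, lcrt_eq, h, mul_add]

theorem lcrt_smul (c : ℂ) (f : 𝓢(EuclideanSpace ℝ (Fin n), ℂ)) :
    lcrt A j (c • f : 𝓢(EuclideanSpace ℝ (Fin n), ℂ)) = c • lcrt A j f := by
  funext x
  have h : foldedRiesz j (chirped A (c • f)) x = c * foldedRiesz j (chirped A f) x := by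
    rw [foldedRiesz, foldedRiesz, mul_smul_comm, ← integral_const_mul]
    congr 2
    funext u
    simp only [chirped, smul_apply, Complex.real_smul, smul_eq_mul]
    ring
  rw [Pi.smul_apply, lcrt_eq, lcrt_eq, h, smul_eq_mul]
  ring

theorem measurable_lcrt (f : 𝓢(EuclideanSpace ℝ (Fin n), ℂ)) : Measurable (lcrt A j f) := by
  have h : lcrt A j f = fun x => (rieszConst n : ℂ) *
      chirp (fun k => A k 0 1) (fun k => -(A k 1 1)) x * foldedRiesz j (chirped A f) x :=
    funext (lcrt_eq A j f)
  rw [h]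
  exact ((contDiff_chirp _ _).continuous.measurable.const_mul _).mul
    (measurable_foldedRiesz (contDiff_chirped A f).continuous)

theorem exists_eLpNorm_lcrt_le {p : ℝ≥0∞} (hp : 1 < p) (hp' : p < ∞) :
    ∃ K : ℝ≥0∞, K ≠ ∞ ∧ ∀ f : 𝓢(EuclideanSpace ℝ (Fin n), ℂ),
      eLpNorm (lcrt A j f) p volume ≤ K * eLpNorm f p volume := by
  have hp1 : 1 < p.toReal := by
    rw [← ENNReal.toReal_one]
    exact (ENNReal.toReal_lt_toReal ENNReal.one_ne_top hp'.ne).2 hp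
  have hp0 : p ≠ 0 := (zero_lt_one.trans hp).ne'
  have hr : 0 ≤ 1 / p.toReal := by positivity
  obtain ⟨C, hC, hb⟩ := exists_lintegral_foldedRiesz_rpow_le j hp1
  refine ⟨‖rieszConst n‖ₑ * C ^ (1 / p.toReal),
    ENNReal.mul_ne_top enorm_ne_top (ENNReal.rpow_ne_top_of_nonneg hr hC), fun f => ?_⟩
  have h1 : eLpNorm (lcrt A j f) p volume ≤
      ‖rieszConst n‖ₑ * eLpNorm (foldedRiesz j (chirped A f)) p volume := by
    refine (eLpNorm_mono_enorm (g := fun x => rieszConst n • foldedRiesz j (chirped A f) x)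
      fun x => le_of_eq ?_).trans (eLpNorm_const_smul_le (c := rieszConst n))
    rw [lcrt_eq, enorm_mul, enorm_mul, enorm_smul]
    congr 1
    rw [← ofReal_norm (chirp _ _ x), norm_chirp, ENNReal.ofReal_one, mul_one, ← ofReal_norm,
      ← ofReal_norm, Complex.norm_real]
  refine h1.trans ?_
  rw [mul_assoc]
  gcongr
  rw [eLpNorm_eq_lintegral_rpow_enorm_toReal hp0 hp'.ne,
    eLpNorm_eq_lintegral_rpow_enorm_toReal hp0 hp'.ne, ← ENNReal.mul_rpow_of_nonneg _ _ hr]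
  refine ENNReal.rpow_le_rpow ((hb _ (contDiff_chirped A f).continuous (integrable_chirped A f)
    (exists_norm_sub_le_of_contDiff (contDiff_chirped A f))).trans (le_of_eq ?_)) hr
  congr 1
  refine lintegral_congr fun x => ?_
  rw [← ofReal_norm, norm_chirped, ofReal_norm]

end

theorem theorem2p3 {n : ℕ} (A : Fin n → Matrix.SpecialLinearGroup (Fin 2) ℝ)
    (hb : ∀ k, A k 0 1 ≠ 0) (had : ∀ k, A k 0 0 = A k 1 1) (j : Fin n) :
    -- the principal value that defines the transform exists for all Schwartz functions
    (∀ (f : 𝓢(EuclideanSpace ℝ (Fin n), ℂ)) (x : EuclideanSpace ℝ (Fin n)),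
      (∀ ε : ℝ, 0 < ε →
        IntegrableOn (lcrtIntegrand A j f x) {y : EuclideanSpace ℝ (Fin n) | ε ≤ ‖x - y‖}) ∧
      ∃ l : ℂ, Tendsto (lcrtTruncated A j f x) (𝓝[>] (0 : ℝ)) (𝓝 l)) ∧
    -- the transform extends to a bounded linear operator on every `L^p`, `1 < p < ∞`
    ∀ (p : ℝ≥0∞) [Fact (1 ≤ p)], 1 < p → p < ∞ →
      ∃ T : Lp ℂ p (volume : Measure (EuclideanSpace ℝ (Fin n))) →L[ℂ]
          Lp ℂ p (volume : Measure (EuclideanSpace ℝ (Fin n))),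
        (∀ f : 𝓢(EuclideanSpace ℝ (Fin n), ℂ), T (f.toLp p) =ᵐ[volume] lcrt A j f) ∧
        ∃ C : ℝ, 0 < C ∧
          ∀ f : Lp ℂ p (volume : Measure (EuclideanSpace ℝ (Fin n))), ‖T f‖ ≤ C * ‖f‖ := by
  refine ⟨fun f x => ⟨fun ε hε => integrableOn_lcrtIntegrand A j f x hε, _,
    tendsto_lcrtTruncated A j f x⟩, fun p _ hp hp' => ?_⟩
  obtain ⟨K, hK, hbound⟩ := exists_eLpNorm_lcrt_le A j hp hp'
  have hmem : ∀ f : 𝓢(EuclideanSpace ℝ (Fin n), ℂ), MemLp (lcrt A j f) p volume := fun f =>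
    ⟨(measurable_lcrt A j f).aestronglyMeasurable,
      (hbound f).trans_lt (ENNReal.mul_lt_top hK.lt_top (f.eLpNorm_lt_top p volume))⟩
  let S : 𝓢(EuclideanSpace ℝ (Fin n), ℂ) →ₗ[ℂ]
      Lp ℂ p (volume : Measure (EuclideanSpace ℝ (Fin n))) :=
    { toFun := fun f => (hmem f).toLp _
      map_add' := fun f g => by
        rw [← MemLp.toLp_add]
        exact MemLp.toLp_congr _ _ (Eventually.of_forall fun x => congrFun (lcrt_add A j f g) x)
      map_smul' := fun c f => by
        rw [RingHom.id_apply, ← MemLp.toLp_const_smul]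
        exact MemLp.toLp_congr _ _ (Eventually.of_forall fun x => congrFun (lcrt_smul A j c f) x) }
  let e : 𝓢(EuclideanSpace ℝ (Fin n), ℂ) →ₗ[ℂ]
      Lp ℂ p (volume : Measure (EuclideanSpace ℝ (Fin n))) :=
    (SchwartzMap.toLpCLM ℂ ℂ p volume).toLinearMap
  have he : DenseRange e := SchwartzMap.denseRange_toLpCLM (F := ℂ) (μ := volume) hp'.ne
  have hnorm : ∀ f, ‖S f‖ ≤ K.toReal * ‖e f‖ := fun f => by
    change ‖(hmem f).toLp _‖ ≤ K.toReal * ‖f.toLp p volume‖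
    rw [Lp.norm_toLp, SchwartzMap.norm_toLp, ← ENNReal.toReal_mul]
    exact ENNReal.toReal_mono (ENNReal.mul_ne_top hK (f.eLpNorm_lt_top p volume).ne) (hbound f)
  refine ⟨S.extendOfNorm e, fun f => ?_, K.toReal + 1, by positivity, fun f => ?_⟩
  · have h : S.extendOfNorm e (f.toLp p volume) = S f :=
      LinearMap.extendOfNorm_eq he ⟨_, hnorm⟩ f
    rw [h]
    exact (hmem f).coeFn_toLp
  · refine (LinearMap.norm_extendOfNorm_apply_le he _ hnorm f).trans ?_
    gcongr
    linarith
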